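/- **Setting.** Equip the symmetric algebra $\mathrm{Sym}(\mathbb{C}^n)$ with its preferred hermitian inner product, for which the monomials $e_1^{a_1}\cdots e_n^{a_n}$ are orthogonal with $\|e_1^{a_1}\cdots e_n^{a_n}\|^2=a_1!\cdots a_n!$; for $\sigma\in\Sigma_n$ let $\sigma_*$ be the isometry of $\mathrm{Sym}(\mathbb{C}^n)$ induced by $e_i\mapsto e_{\sigma(i)}$. *Configurations.* For a complex inner product space $\mathcal{U}$ of finite or countable dimension and a finite-dimensional inner product space $W$, let $L(W,\mathcal U)=\mathrm{colim}_{V}L(W,V)$ be the space of linear isometric embeddings, where $V$ runs over the finite-dimensional subspaces of $\mathcal U$ and $L(W,V)$ is a Stiefel manifold. For $\langle k\rangle=\{0,\dots,k\}$, based at $0$, let $$ku(\langle k\rangle,\mathcal U)=\bigsqcup_{d_1,\dots,d_k\ge 0}L(\mathbb{C}^{d_1}\oplus\dots\oplus\mathbb{C}^{d_k},\mathcal U)/(U(d_1)\times\dots\times U(d_k)),$$ the space of $k$-tuples $(V_1,\dots,V_k)$ of mutually orthogonal finite-dimensional subspaces of $\mathcal U$. A based map $\alpha:\langle k\rangle\to\langle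 l\rangle$ sends $(V_j)_j$ to $(\bigoplus_{\alpha(j)=i}V_j)_{i=1}^l$. For a pointed compact Hausdorff space $X$ let $ku(X,\mathcal U)$ be the coend $\int^{\langle k\rangle}ku(\langle k\rangle,\mathcal U)\times\mathrm{Map}_*(\langle k\rangle,X)$, whose points are classes $[(V_1,x_1),\dots,(V_k,x_k)]$ of configurations of points $x_i\in X$ labelled by mutually orthogonal subspaces $V_i$. Let $S^n=(\mathbb{R}^n)^+$ be the one-point compactification of $\mathbb{R}^n$ with basepoint $\infty$, on which $\Sigma_n$ acts by $\sigma(x_1,\dots,x_n)=(x_{\sigma^{-1}(1)},\dots,x_{\sigma^{-1}(n)})$ and $\sigma\infty=\infty$. Put $ku_n=ku(S^n,\mathrm{Sym}(\mathbb{C}^n))$, with basepoint $[(0,\infty)]$ and with the action $\sigma\cdot[(V_i,x_i)_i]=[(\sigma_*(V_i),\sigma x_i)_i]$. *Commuting unitaries.* Let $U(\mathcal U)=\mathrm{colim}_V U(V)$ be the stable unitary group, where $V$ runs over the finite-dimensional subspaces of $\mathcal U$ and unitaries of $V$ are extended by the identity on $V^\perp$. Let $C_n(U(\mathcal U))\subseteq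 U(\mathcal U)^n$ be the subspace of $n$-tuples of pairwise commuting elements. Write $(A_1,\dots,A_n)\sim(B_1,\dots,B_n)$ if $\sum_i\ker(A_i-\mathrm{Id})=\sum_i\ker(B_i-\mathrm{Id})$ and, for each $i$, $A_i$ and $B_i$ agree on the orthogonal complement of this subspace. For $n\ge1$ let $\overline{\mathscr C}_n=C_n(U(\mathrm{Sym}(\mathbb{C}^n)))/{\sim}$, with basepoint $[(\mathrm{Id},\dots,\mathrm{Id})]$ and with the $\Sigma_n$-action $$\sigma\cdot[(A_1,\dots,A_n)]=[(\sigma_*A_{\sigma^{-1}(1)}\sigma_*^{-1},\dots,\sigma_*A_{\sigma^{-1}(n)}\sigma_*^{-1})];$$ and let $\overline{\mathscr C}_0=S^0$. **Lemma 2.2.** For every $n\ge0$ there is a $\Sigma_n$-equivariant based homeomorphism $$\Phi_n:\ ku_n\xrightarrow{\ \cong\ }\overline{\mathscr C}_n .$$ For $n\ge1$ it can be chosen as follows. Let $c:S^1=\mathbb{R}\cup\{\infty\}\to\mathbb{C}$ be given by $c(t)=(it-1)(it+1)^{-1}$ and $c(\infty)=1$, and for $t_1,\dots,t_n\in S^1$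 let $t_1\wedge\dots\wedge t_n\in S^n$ be the point $(t_1,\dots,t_n)$ of $\mathbb{R}^n$ if all $t_j\neq\infty$, and $\infty$ otherwise. Then for all mutually orthogonal finite-dimensional subspaces $V_1,\dots,V_k$ of $\mathrm{Sym}(\mathbb{C}^n)$ and all $x_i=x_{i1}\wedge\dots\wedge x_{in}\in S^n$ with $x_{ij}\in S^1$, $$\Phi_n\big([(V_1,x_1),\dots,(V_k,x_k)]\big)=[(A_1,\dots,A_n)],$$ where $(A_1,\dots,A_n)$ is the commuting tuple such that $A_j$ is multiplication by $c(x_{ij})$ on $V_i$ for $i=1,\dots,k$, and is the identity on the orthogonal complement of $\bigoplus_iV_i$. -/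

import Mathlib

open TopologicalSpace
open scoped Nat OnePoint

noncomputable section

namespace KuModel

/-! ### Mutually orthogonal tuples of finite dimensional subspaces -/

section Labels

variable (W U : Type) [NormedAddCommGroup W] [InnerProductSpace ℂ W]
  [NormedAddCommGroup U] [InnerProductSpace ℂ U]

/-- The set `L(W, U)` of linear isometric embeddings of a finite dimensional `W` into `U`,
with the topology defined below. -/
def Emb : Type := W →ₗᵢ[ℂ] U

/-- The operator norm topology on the isometric embeddings (for `W` and `V` finite dimensional,
this is the topology of the Stiefel manifold). -/
@[reducible] def stiefelTopology (V : Type) [NormedAddCommGroup V] [InnerProductSpace ℂ V] :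
    TopologicalSpace (W →ₗᵢ[ℂ] V) :=
  TopologicalSpace.induced (fun f => f.toContinuousLinearMap) inferInstance

/-- `L(W, U)` is the colimit of the Stiefel manifolds `L(W, V)`, where `V` ranges over the finite
dimensional subspaces of `U`: it has the finest topology that makes the inclusions continuous. -/
instance : TopologicalSpace (Emb W U) :=
  ⨆ (V : Submodule ℂ U) (_ : FiniteDimensional ℂ V),
    TopologicalSpace.coinduced (fun f : W →ₗᵢ[ℂ] V => V.subtypeₗᵢ.comp f) (stiefelTopology W V)

variable (k : ℕ)

/-- `ku(⟨k⟩, U)`: the `k`-tuples of mutually orthogonal, finite dimensional subspaces of `U`. -/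
def OrthTuple : Type :=
  {V : Fin k → Submodule ℂ U // (∀ i, FiniteDimensional ℂ (V i)) ∧ Pairwise fun i j => V i ⟂ V j}

variable {U k}

/-- The tuple of subspaces `(f(ℂ^{d₁}), …, f(ℂ^{dₖ}))` given by an isometric embedding
`f : ℂ^{d₁} ⊕ ⋯ ⊕ ℂ^{dₖ} → U`.  Two embeddings give the same tuple if and only if they differ by
precomposition with an element of `U(d₁) × ⋯ × U(dₖ)`. -/
def OrthTuple.ofEmb (d : Fin k → ℕ) (f : Emb (EuclideanSpace ℂ (Σ i : Fin k, Fin (d i))) U) :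
    OrthTuple U k :=
  ⟨fun i => Submodule.span ℂ (Set.range fun a : Fin (d i) =>
      (show EuclideanSpace ℂ (Σ i : Fin k, Fin (d i)) →ₗᵢ[ℂ] U from f)
        (EuclideanSpace.single ⟨i, a⟩ 1)),
    fun i => FiniteDimensional.span_of_finite ℂ (Set.finite_range _), by
    intro i j hij
    refine Submodule.isOrtho_span.mpr ?_
    rintro _ ⟨a, rfl⟩ _ ⟨b, rfl⟩
    rw [LinearIsometry.inner_map_map, EuclideanSpace.inner_single_left]
    simp [hij]⟩

/-- The topology of the disjoint union of the spaces
`L(ℂ^{d₁} ⊕ ⋯ ⊕ ℂ^{dₖ}, U) / (U(d₁) × ⋯ × U(dₖ))` over all `d₁, …, dₖ ≥ 0`. -/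
instance : TopologicalSpace (OrthTuple U k) :=
  TopologicalSpace.coinduced
    (fun p : Σ d : Fin k → ℕ, Emb (EuclideanSpace ℂ (Σ i : Fin k, Fin (d i))) U =>
      OrthTuple.ofEmb p.1 p.2) inferInstance

/-- The functoriality of `ku(-, U)` in a map `α : ⟨k⟩ → ⟨l⟩` of pointed sets, where
`⟨k⟩ = {0, …, k}` has basepoint `0` (entries sent to the basepoint are dropped):
the `i`-th entry of the image is the sum of the `V j` with `α j = i`. -/
def OrthTuple.push {l : ℕ} (α : Fin (k + 1) → Fin (l + 1)) (V : OrthTuple U k) : OrthTuple U l :=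
  ⟨fun i => ⨆ j : {j : Fin k // α j.succ = i.succ}, V.1 j,
    fun _ => by
      have := V.2.1
      exact Submodule.finiteDimensional_iSup _, by
    intro i i' hi
    refine Submodule.isOrtho_iSup_left.mpr fun ⟨j, hj⟩ =>
      Submodule.isOrtho_iSup_right.mpr fun ⟨j', hj'⟩ => ?_
    refine V.2.2 ?_
    rintro rfl
    exact hi (Fin.succ_injective _ (hj.symm.trans hj'))⟩

/-- The image of a tuple of subspaces under a linear isometry of `U`. -/
def OrthTuple.map (g : U ≃ₗᵢ[ℂ] U) (V : OrthTuple U k) : OrthTuple U k :=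
  ⟨fun i => (V.1 i).map (g.toLinearEquiv : U →ₗ[ℂ] U),
    fun i => by
      have := V.2.1 i
      infer_instance,
    fun _ _ hij => (V.2.2 hij).map g.toLinearIsometry⟩

end Labels

/-! ### The space `ku(X, U)` -/

section Coend

variable {X : Type} (pt : X) (U : Type) [NormedAddCommGroup U] [InnerProductSpace ℂ U]

/-- The disjoint union of the spaces `ku(⟨k⟩, U) × Map_*(⟨k⟩, X)`; a based map `⟨k⟩ → X` is
recorded as the tuple of its values at `1, …, k`. -/
abbrev Labelled (X U : Type) [NormedAddCommGroup U] [InnerProductSpace ℂ U] : Type :=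
  Σ k : ℕ, OrthTuple U k × (Fin k → X)

/-- The composite of `α : ⟨k⟩ → ⟨l⟩` with the based map `⟨l⟩ → X` with values `x` on `1, …, l`. -/
def pull {k l : ℕ} (α : Fin (k + 1) → Fin (l + 1)) (x : Fin l → X) : Fin k → X :=
  fun j => (Fin.cons pt x : Fin (l + 1) → X) (α j.succ)

/-- The identifications `(α_* V, x) ∼ (V, α^* x)` of the coend, for based `α : ⟨k⟩ → ⟨l⟩`. -/
inductive CoendRel : Labelled X U → Labelled X U → Prop
  | glue {k l : ℕ} (α : Fin (k + 1) → Fin (l + 1)) (hα : α 0 = 0) (V : OrthTuple U k)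
      (x : Fin l → X) : CoendRel ⟨l, V.push α, x⟩ ⟨k, V, pull pt α x⟩

/-- The coend `ku(X, U) = ∫^{⟨k⟩} ku(⟨k⟩, U) × Map_*(⟨k⟩, X)`, for a pointed space `X`, with the
quotient topology.  (It is used for compact Hausdorff `X` and for `U` of countable dimension;
then the product topology on `ku(⟨k⟩, U) × X^k` is compactly generated.) -/
def KU : Type := Quot (CoendRel pt U)

instance [TopologicalSpace X] : TopologicalSpace (KU pt U) :=
  inferInstanceAs (TopologicalSpace (Quot (CoendRel pt U)))

variable {U}

/-- The class `[(V₁, x₁), …, (Vₖ, xₖ)]`. -/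
def KU.mk {k : ℕ} (V : OrthTuple U k) (x : Fin k → X) : KU pt U := Quot.mk _ ⟨k, V, x⟩

variable (U) in
/-- The basepoint `[(0, *)]`. -/
def KU.base : KU pt U :=
  KU.mk pt (⟨fun _ : Fin 1 => ⊥, fun _ => inferInstance,
    fun _ _ _ => Submodule.isOrtho_bot_left⟩ : OrthTuple U 1) (fun _ => pt)

/-- The map `[(V₁, x₁), …, (Vₖ, xₖ)] ↦ [(g V₁, h x₁), …, (g Vₖ, h xₖ)]` induced by an isometry `g`
of `U` and a based map `h`. -/
def KU.map (g : U ≃ₗᵢ[ℂ] U) (h : X → X) (hpt : h pt = pt) : KU pt U → KU pt U :=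
  Quot.map (fun p => ⟨p.1, p.2.1.map g, fun i => h (p.2.2 i)⟩) (by
    rintro _ _ ⟨α, hα, V, x⟩
    have h1 : (V.push α).map g = (V.map g).push α := by
      refine Subtype.ext (funext fun i => ?_)
      simp [OrthTuple.map, OrthTuple.push, Submodule.map_iSup]
    have h2 : (fun i => h (pull pt α x i)) = pull pt α (fun i => h (x i)) := by
      funext i
      simp only [pull]
      refine Fin.cases ?_ (fun j => ?_) (α i.succ) <;> simp [hpt]
    simp only [h1, h2]
    exact CoendRel.glue α hα (V.map g) _)

end Coend

/-! ### Commuting tuples of stable unitaries -/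

section Commuting

variable (U : Type) [NormedAddCommGroup U] [InnerProductSpace ℂ U]

/-- The stable unitary group of `U`, as a set: the unitary transformations of `U` that are the
identity on the orthogonal complement of some finite dimensional subspace. -/
def stableUnitary : Subgroup (U ≃ₗᵢ[ℂ] U) where
  carrier := {A | ∃ V : Submodule ℂ U, FiniteDimensional ℂ V ∧ ∀ x ∈ Vᗮ, A x = x}
  one_mem' := ⟨⊥, inferInstance, fun _ _ => rfl⟩
  mul_mem' := by
    rintro A B ⟨V, hV, hA⟩ ⟨W, hW, hB⟩
    refine ⟨V ⊔ W, inferInstance, fun x hx => ?_⟩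
    rw [LinearIsometryEquiv.coe_mul, Function.comp_apply,
      hB x (Submodule.orthogonal_le le_sup_right hx),
      hA x (Submodule.orthogonal_le le_sup_left hx)]
  inv_mem' := by
    rintro A ⟨V, hV, hA⟩
    refine ⟨V, hV, fun x hx => ?_⟩
    conv_lhs => rw [← hA x hx]
    exact A.symm_apply_apply x

variable {U} in
/-- The linear map that is `B` on `V` and the identity on the orthogonal complement of `V`. -/
def extendLin (V : Submodule ℂ U) [FiniteDimensional ℂ V] (B : V ≃ₗᵢ[ℂ] V) : U →ₗ[ℂ] U :=
  V.subtype ∘ₗ (B.toLinearEquiv : V →ₗ[ℂ] V) ∘ₗ (V.orthogonalProjectionOnto : U →L[ℂ] V) +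
    (LinearMap.id - V.subtype ∘ₗ (V.orthogonalProjectionOnto : U →L[ℂ] V))

variable {U} in
theorem extendLin_apply (V : Submodule ℂ U) [FiniteDimensional ℂ V] (B : V ≃ₗᵢ[ℂ] V) (x : U) :
    extendLin V B x =
      B (V.orthogonalProjectionOnto x) + (x - V.orthogonalProjectionOnto x) := rfl

variable {U} in
theorem proj_extendLin (V : Submodule ℂ U) [FiniteDimensional ℂ V] (B : V ≃ₗᵢ[ℂ] V) (x : U) :
    V.orthogonalProjectionOnto (extendLin V B x) = B (V.orthogonalProjectionOnto x) := by
  have h : V.orthogonalProjectionOnto (x - V.orthogonalProjectionOnto x) = 0 := by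
    rw [map_sub, Submodule.orthogonalProjectionOnto_mem_subspace_eq_self, sub_self]
  rw [extendLin_apply, map_add, h, Submodule.orthogonalProjectionOnto_mem_subspace_eq_self,
    add_zero]

variable {U} in
theorem extendLin_extendLin (V : Submodule ℂ U) [FiniteDimensional ℂ V] (B C : V ≃ₗᵢ[ℂ] V)
    (h : ∀ v, C (B v) = v) (x : U) : extendLin V C (extendLin V B x) = x := by
  rw [extendLin_apply V C, proj_extendLin, h, extendLin_apply]
  abel

variable {U} in
theorem norm_extendLin (V : Submodule ℂ U) [FiniteDimensional ℂ V] (B : V ≃ₗᵢ[ℂ] V) (x : U) :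
    ‖extendLin V B x‖ = ‖x‖ := by
  have key : ∀ v : V, ‖(v : U) + (x - V.orthogonalProjectionOnto x)‖ ^ 2 =
      ‖v‖ ^ 2 + ‖x - V.orthogonalProjectionOnto x‖ ^ 2 := by
    intro v
    have h : inner ℂ (v : U) (x - V.orthogonalProjectionOnto x) = 0 :=
      V.sub_starProjection_mem_orthogonal x v v.2
    have := norm_add_sq_eq_norm_sq_add_norm_sq_of_inner_eq_zero _ _ h
    simpa only [sq, Submodule.coe_norm] using this
  have h1 := key (B (V.orthogonalProjectionOnto x))
  have h2 := key (V.orthogonalProjectionOnto x)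
  rw [add_sub_cancel] at h2
  rw [LinearIsometryEquiv.norm_map, ← h2] at h1
  exact (sq_eq_sq₀ (norm_nonneg _) (norm_nonneg _)).mp h1

variable {U} in
/-- The inclusion `U(V) → U(U)`: extend a unitary transformation of a finite dimensional subspace
`V` by the identity on the orthogonal complement of `V`. -/
def extendById (V : Submodule ℂ U) [FiniteDimensional ℂ V] (B : V ≃ₗᵢ[ℂ] V) : stableUnitary U :=
  ⟨{ extendLin V B with
      invFun := extendLin V B.symm
      left_inv := extendLin_extendLin V B B.symm B.symm_apply_apply
      right_inv := extendLin_extendLin V B.symm B B.apply_symm_apply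
      norm_map' := norm_extendLin V B },
    V, inferInstance, fun x hx => by
      change extendLin V B x = x
      have : V.orthogonalProjectionOnto x = 0 :=
        V.orthogonalProjectionOnto_eq_zero_iff.mpr hx
      rw [extendLin_apply, this]
      simp⟩

/-- The operator norm topology on the unitary group of a finite dimensional space. -/
@[reducible] def unitaryTopology (V : Type) [NormedAddCommGroup V] [InnerProductSpace ℂ V] :
    TopologicalSpace (V ≃ₗᵢ[ℂ] V) :=
  TopologicalSpace.induced (fun A => A.toLinearIsometry.toContinuousLinearMap) inferInstance

/-- The colimit topology on the stable unitary group: the finest topology that makes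
`U(V) → U(U)` continuous for all finite dimensional subspaces `V` of `U`. -/
instance : TopologicalSpace (stableUnitary U) :=
  ⨆ (V : Submodule ℂ U) (_ : FiniteDimensional ℂ V),
    TopologicalSpace.coinduced (extendById V) (unitaryTopology V)

/-- `C_n(U(U))`, a subspace of `U(U)^n`.  (For `U` of countable dimension the product topology on
`U(U)^n` is compactly generated.) -/
abbrev CommTuple (n : ℕ) : Type :=
  {A : Fin n → stableUnitary U // ∀ i j, A i * A j = A j * A i}

variable {U} {n : ℕ}

/-- `∑ i, ker (A i - Id)`. -/
def CommTuple.fixedSum (A : CommTuple U n) : Submodule ℂ U :=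
  ⨆ i, LinearMap.ker (((A.1 i).1.toLinearEquiv : U →ₗ[ℂ] U) - LinearMap.id)

variable (U n) in
/-- `A ∼ B` if `∑ i, ker (A i - Id) = ∑ i, ker (B i - Id)` and `A i`, `B i` agree on the orthogonal
complement of this subspace for all `i`. -/
def commSetoid : Setoid (CommTuple U n) where
  r A B := A.fixedSum = B.fixedSum ∧ ∀ i, ∀ x ∈ A.fixedSumᗮ, (A.1 i).1 x = (B.1 i).1 x
  iseqv :=
    { refl := fun _ => ⟨rfl, fun _ _ _ => rfl⟩
      symm := fun h => ⟨h.1.symm, fun i x hx => (h.2 i x (h.1 ▸ hx)).symm⟩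
      trans := fun h h' =>
        ⟨h.1.trans h'.1, fun i x hx => (h.2 i x hx).trans (h'.2 i x (h.1 ▸ hx))⟩ }

theorem conj_mem (g : U ≃ₗᵢ[ℂ] U) {A : U ≃ₗᵢ[ℂ] U} (hA : A ∈ stableUnitary U) :
    g * A * g⁻¹ ∈ stableUnitary U := by
  obtain ⟨V, hV, h⟩ := hA
  refine ⟨V.map (g.toLinearEquiv : U →ₗ[ℂ] U), inferInstance, fun x hx => ?_⟩
  have : g⁻¹ x ∈ Vᗮ := by
    rw [Submodule.mem_orthogonal] at hx ⊢
    intro v hv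
    rw [← hx (g v) ⟨v, hv, rfl⟩, ← g.inner_map_map]
    exact congrArg (inner ℂ (g v)) (g.apply_symm_apply x)
  change g (A (g⁻¹ x)) = x
  rw [h _ this]
  exact g.apply_symm_apply x

/-- The tuple `(g A_{σ⁻¹(1)} g⁻¹, …, g A_{σ⁻¹(n)} g⁻¹)`. -/
def CommTuple.act (g : U ≃ₗᵢ[ℂ] U) (σ : Equiv.Perm (Fin n)) (A : CommTuple U n) : CommTuple U n :=
  ⟨fun i => ⟨g * (A.1 (σ⁻¹ i)).1 * g⁻¹, conj_mem g (A.1 (σ⁻¹ i)).2⟩, fun i j => by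
    have : (A.1 (σ⁻¹ i)).1 * (A.1 (σ⁻¹ j)).1 = (A.1 (σ⁻¹ j)).1 * (A.1 (σ⁻¹ i)).1 :=
      congrArg Subtype.val (A.2 (σ⁻¹ i) (σ⁻¹ j))
    refine Subtype.ext ?_
    change g * (A.1 (σ⁻¹ i)).1 * g⁻¹ * (g * (A.1 (σ⁻¹ j)).1 * g⁻¹) =
      g * (A.1 (σ⁻¹ j)).1 * g⁻¹ * (g * (A.1 (σ⁻¹ i)).1 * g⁻¹)
    rw [conj_mul, conj_mul, this]⟩

theorem CommTuple.fixedSum_act (g : U ≃ₗᵢ[ℂ] U) (σ : Equiv.Perm (Fin n)) (A : CommTuple U n) :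
    (A.act g σ).fixedSum = A.fixedSum.map (g.toLinearEquiv : U →ₗ[ℂ] U) := by
  rw [fixedSum, fixedSum, Submodule.map_iSup]
  refine Eq.trans ?_ (Equiv.iSup_comp σ⁻¹)
  refine iSup_congr fun i => Submodule.ext fun x => ?_
  rw [LinearMap.mem_ker, Submodule.mem_map]
  change g ((A.1 (σ⁻¹ i)).1 (g.symm x)) - x = 0 ↔ ∃ y, (A.1 (σ⁻¹ i)).1 y - y = 0 ∧ g y = x
  constructor
  · intro h
    refine ⟨g.symm x, ?_, g.apply_symm_apply x⟩
    apply g.injective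
    rw [map_sub, g.apply_symm_apply, h, map_zero]
  · rintro ⟨y, hy, rfl⟩
    rw [g.symm_apply_apply, ← map_sub, hy, map_zero]

variable (U n) in
/-- The quotient space `C_n(U(U)) / ∼` (with the quotient topology). -/
def CommQuot : Type := Quotient (commSetoid U n)

instance : TopologicalSpace (CommQuot U n) :=
  inferInstanceAs (TopologicalSpace (Quotient (commSetoid U n)))

/-- The class `[(A₁, …, Aₙ)]`. -/
def CommQuot.mk (A : CommTuple U n) : CommQuot U n := Quotient.mk (commSetoid U n) A

/-- The map `[(A₁, …, Aₙ)] ↦ [(g A_{σ⁻¹(1)} g⁻¹, …, g A_{σ⁻¹(n)} g⁻¹)]`. -/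
def CommQuot.act (g : U ≃ₗᵢ[ℂ] U) (σ : Equiv.Perm (Fin n)) : CommQuot U n → CommQuot U n :=
  Quotient.map (fun A => A.act g σ) (by
    rintro A B ⟨h1, h2⟩
    refine ⟨by rw [CommTuple.fixedSum_act, CommTuple.fixedSum_act, h1], fun i x hx => ?_⟩
    rw [CommTuple.fixedSum_act] at hx
    have : g.symm x ∈ A.fixedSumᗮ := by
      rw [Submodule.mem_orthogonal] at hx ⊢
      intro v hv
      rw [← hx (g v) ⟨v, hv, rfl⟩, ← g.inner_map_map, g.apply_symm_apply]
    exact congrArg g (h2 (σ⁻¹ i) _ this))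

end Commuting

/-! ### The symmetric algebra `Sym(ℂⁿ)` as an inner product space -/

section Sym

/-- The symmetric algebra of `ℂⁿ`. -/
def SymC (n : ℕ) : Type := SymmetricAlgebra ℂ (EuclideanSpace ℂ (Fin n))

namespace SymC

variable {n : ℕ}

instance : AddCommGroup (SymC n) :=
  inferInstanceAs (AddCommGroup (SymmetricAlgebra ℂ (EuclideanSpace ℂ (Fin n))))

instance : Module ℂ (SymC n) :=
  inferInstanceAs (Module ℂ (SymmetricAlgebra ℂ (EuclideanSpace ℂ (Fin n))))

variable (n) in
/-- The basis of `Sym(ℂⁿ)` that consists of the monomials in the standard basis of `ℂⁿ`. -/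
def monomials : Module.Basis (Fin n →₀ ℕ) ℂ (SymC n) :=
  ((EuclideanSpace.basisFun (Fin n) ℂ).toBasis.symmetricAlgebra :
    Module.Basis (Fin n →₀ ℕ) ℂ (SymmetricAlgebra ℂ (EuclideanSpace ℂ (Fin n))))

theorem monomials_apply (a : Fin n →₀ ℕ) :
    @Eq (SymmetricAlgebra ℂ (EuclideanSpace ℂ (Fin n))) (monomials n a)
      (∏ i, SymmetricAlgebra.ι ℂ (EuclideanSpace ℂ (Fin n)) (EuclideanSpace.single i 1) ^ a i) := by
  change (EuclideanSpace.basisFun (Fin n) ℂ).toBasis.symmetricAlgebra a = _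
  simp only [Module.Basis.symmetricAlgebra, Module.Basis.map_apply, MvPolynomial.coe_basisMonomials]
  change (SymmetricAlgebra.equivMvPolynomial _).symm _ = _
  rw [MvPolynomial.monomial_eq, Finsupp.prod_fintype _ _ (by simp)]
  simp

/-- The preferred inner product on `Sym(ℂⁿ)`: the monomials `e₁^{a₁} ⋯ eₙ^{aₙ}` are orthogonal, of
square norm `a₁! ⋯ aₙ!`.  (So `⟨v₁ ⋯ vₘ, w₁ ⋯ wₘ⟩ = ∑_σ ∏ᵢ ⟨vᵢ, w_{σ(i)}⟩`.) -/
def innerSym (p q : SymC n) : ℂ :=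
  ((monomials n).repr p).sum fun a c =>
    starRingEnd ℂ c * (monomials n).repr q a * (∏ i, (a i)! : ℕ)

theorem innerSym_eq (p q : SymC n) (s : Finset (Fin n →₀ ℕ))
    (hs : ((monomials n).repr p).support ⊆ s) :
    innerSym p q = ∑ a ∈ s, starRingEnd ℂ ((monomials n).repr p a) * (monomials n).repr q a *
      (∏ i, (a i)! : ℕ) :=
  Finsupp.sum_of_support_subset _ hs _ (by simp)

variable (n) in
/-- The axioms of an inner product for `innerSym`. -/
@[reducible] def core : InnerProductSpace.Core ℂ (SymC n) where
  inner := innerSym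
  conj_inner_symm p q := by
    classical
    rw [innerSym_eq p q _ (Finset.subset_union_left (s₂ := ((monomials n).repr q).support)),
      innerSym_eq q p _ (Finset.subset_union_right (s₁ := ((monomials n).repr p).support)),
      map_sum]
    refine Finset.sum_congr rfl fun a _ => ?_
    simp only [map_mul, Complex.conj_conj, map_natCast]
    ring
  re_inner_nonneg p := by
    rw [innerSym, Finsupp.sum, map_sum]
    refine Finset.sum_nonneg fun a _ => ?_
    rw [← Complex.normSq_eq_conj_mul_self, ← Complex.ofReal_natCast, ← Complex.ofReal_mul]
    exact mul_nonneg (Complex.normSq_nonneg _) (Nat.cast_nonneg _)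
  add_left p q r := by
    classical
    rw [innerSym_eq (p + q) r (((monomials n).repr p).support ∪ ((monomials n).repr q).support)
        (by rw [map_add]; exact Finsupp.support_add),
      innerSym_eq p r _ (Finset.subset_union_left (s₂ := ((monomials n).repr q).support)),
      innerSym_eq q r _ (Finset.subset_union_right (s₁ := ((monomials n).repr p).support)),
      ← Finset.sum_add_distrib]
    refine Finset.sum_congr rfl fun a _ => ?_
    simp only [map_add, Finsupp.add_apply]
    ring
  smul_left p q c := by
    rw [innerSym_eq (c • p) q ((monomials n).repr p).support
        (by rw [map_smul]; exact Finsupp.support_smul), innerSym, Finsupp.sum, Finset.mul_sum]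
    refine Finset.sum_congr rfl fun a _ => ?_
    simp only [map_smul, Finsupp.smul_apply, smul_eq_mul, map_mul]
    ring
  definite p hp := by
    have hp : innerSym p p = 0 := hp
    rw [innerSym, Finsupp.sum] at hp
    have h2 := congrArg Complex.re hp
    simp only [Complex.re_sum, ← Complex.normSq_eq_conj_mul_self, ← Complex.ofReal_natCast,
      ← Complex.ofReal_mul, Complex.ofReal_re, Complex.zero_re] at h2
    rw [Finset.sum_eq_zero_iff_of_nonneg
      (fun a _ => mul_nonneg (Complex.normSq_nonneg _) (Nat.cast_nonneg _))] at h2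
    refine (monomials n).repr.map_eq_zero_iff.mp (Finsupp.ext fun a => ?_)
    by_contra ha
    have h3 := h2 a (Finsupp.mem_support_iff.mpr ha)
    rcases mul_eq_zero.mp h3 with h4 | h4
    · exact ha (Complex.normSq_eq_zero.mp h4)
    · exact Finset.prod_ne_zero_iff.mpr (fun i _ => Nat.factorial_ne_zero _) (Nat.cast_eq_zero.mp h4)

instance : NormedAddCommGroup (SymC n) := (core n).toNormedAddCommGroup

instance : InnerProductSpace ℂ (SymC n) := InnerProductSpace.ofCore (core n).toCore

theorem inner_eq (p q : SymC n) : inner ℂ p q = innerSym p q := rfl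

/-- The algebra endomorphism of `Sym(ℂⁿ)` induced by the permutation `e_i ↦ e_{σ(i)}` of the
standard basis of `ℂⁿ`. -/
def permHom (σ : Equiv.Perm (Fin n)) : SymmetricAlgebra ℂ (EuclideanSpace ℂ (Fin n)) →ₐ[ℂ]
    SymmetricAlgebra ℂ (EuclideanSpace ℂ (Fin n)) :=
  SymmetricAlgebra.lift (SymmetricAlgebra.ι ℂ _ ∘ₗ
    ((LinearIsometryEquiv.piLpCongrLeft 2 ℂ ℂ σ).toLinearEquiv :
      EuclideanSpace ℂ (Fin n) →ₗ[ℂ] EuclideanSpace ℂ (Fin n)))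

theorem permHom_ι (σ : Equiv.Perm (Fin n)) (v : EuclideanSpace ℂ (Fin n)) :
    permHom σ (SymmetricAlgebra.ι ℂ _ v) =
      SymmetricAlgebra.ι ℂ _ (LinearIsometryEquiv.piLpCongrLeft 2 ℂ ℂ σ v) :=
  SymmetricAlgebra.lift_ι_apply _ _

/-- `permHom` as a linear map. -/
def permLin (σ : Equiv.Perm (Fin n)) : SymC n →ₗ[ℂ] SymC n := (permHom σ).toLinearMap

theorem permHom_mul (σ τ : Equiv.Perm (Fin n)) (p : SymmetricAlgebra ℂ (EuclideanSpace ℂ (Fin n))) :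
    permHom (σ * τ) p = permHom σ (permHom τ p) := by
  suffices permHom (σ * τ) = (permHom σ).comp (permHom τ) from congrArg (fun f => f p) this
  refine SymmetricAlgebra.algHom_ext (LinearMap.ext fun v => ?_)
  change permHom (σ * τ) (SymmetricAlgebra.ι ℂ _ v) =
    permHom σ (permHom τ (SymmetricAlgebra.ι ℂ _ v))
  rw [permHom_ι, permHom_ι, permHom_ι]
  rfl

theorem permHom_one (p : SymmetricAlgebra ℂ (EuclideanSpace ℂ (Fin n))) :
    permHom (1 : Equiv.Perm (Fin n)) p = p := by
  suffices permHom (1 : Equiv.Perm (Fin n)) = AlgHom.id ℂ _ from congrArg (fun f => f p) this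
  refine SymmetricAlgebra.algHom_ext (LinearMap.ext fun v => ?_)
  change permHom 1 (SymmetricAlgebra.ι ℂ _ v) = SymmetricAlgebra.ι ℂ _ v
  rw [permHom_ι]
  rfl

theorem permHom_monomials (σ : Equiv.Perm (Fin n)) (a : Fin n →₀ ℕ) :
    permLin σ (monomials n a) = monomials n (Finsupp.equivMapDomain σ a) := by
  refine (congrArg (permHom σ) (monomials_apply a)).trans (Eq.trans ?_ (monomials_apply _).symm)
  simp only [map_prod, map_pow, permHom_ι]
  refine Fintype.prod_equiv σ _ _ fun i => ?_
  simp only [Finsupp.equivMapDomain_apply, Equiv.symm_apply_apply]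
  congr 2
  exact LinearIsometryEquiv.piLpCongrLeft_single σ i 1

theorem repr_permLin (σ : Equiv.Perm (Fin n)) (p : SymC n) :
    (monomials n).repr (permLin σ p) =
      Finsupp.equivMapDomain (Finsupp.equivCongrLeft σ) ((monomials n).repr p) := by
  have : (monomials n).repr.toLinearMap ∘ₗ permLin σ =
      (Finsupp.domLCongr (R := ℂ) (M := ℂ)
        (Finsupp.equivCongrLeft (M := ℕ) σ)).toLinearMap ∘ₗ (monomials n).repr.toLinearMap := by
    refine (monomials n).ext fun a => ?_
    simp [permHom_monomials]
  exact congrArg (fun f => f p) this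

/-- The isometry `σ_*` of `Sym(ℂⁿ)` induced by a permutation `σ`. -/
def perm (σ : Equiv.Perm (Fin n)) : SymC n ≃ₗᵢ[ℂ] SymC n :=
  LinearEquiv.isometryOfInner
    { permLin σ with
      invFun := permLin σ⁻¹
      left_inv := fun p => by
        refine (permHom_mul σ⁻¹ σ p).symm.trans ?_
        rw [inv_mul_cancel]
        exact permHom_one p
      right_inv := fun p => by
        refine (permHom_mul σ σ⁻¹ p).symm.trans ?_
        rw [mul_inv_cancel]
        exact permHom_one p }
    (by
      intro p q
      change innerSym (permLin σ p) (permLin σ q) = innerSym p q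
      rw [innerSym, repr_permLin, repr_permLin, Finsupp.sum_equivMapDomain, innerSym]
      refine Finsupp.sum_congr fun a _ => ?_
      rw [Finsupp.equivMapDomain_apply, Equiv.symm_apply_apply]
      congr 2
      refine (Fintype.prod_equiv σ _ _ fun i => ?_).symm
      simp)

theorem perm_mul (σ τ : Equiv.Perm (Fin n)) : perm (σ * τ) = perm σ * perm τ :=
  LinearIsometryEquiv.ext fun p => permHom_mul σ τ p

theorem perm_one : perm (1 : Equiv.Perm (Fin n)) = 1 :=
  LinearIsometryEquiv.ext fun p => permHom_one p

end SymC

end Sym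

/-! ### The spaces `ku_n` and `𝒞̄_n` with their `Σ_n`-actions -/

section Spaces

variable {n : ℕ}

/-- The sphere `Sⁿ`, the one-point compactification of `ℝⁿ`, with basepoint `∞`. -/
abbrev Sphere (n : ℕ) : Type := OnePoint (Fin n → ℝ)

/-- The action of `σ` on `Sⁿ`: `σ (x₁, …, xₙ) = (x_{σ⁻¹(1)}, …, x_{σ⁻¹(n)})` and `σ ∞ = ∞`. -/
def sphereAct (σ : Equiv.Perm (Fin n)) : Sphere n → Sphere n :=
  OnePoint.map fun x i => x (σ⁻¹ i)

/-- `x₁ ∧ ⋯ ∧ xₙ ∈ Sⁿ = S¹ ∧ ⋯ ∧ S¹` for `x₁, …, xₙ ∈ S¹ = ℝ ∪ {∞}`: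
the basepoint if some `xⱼ = ∞`, and the point `(x₁, …, xₙ)` of `ℝⁿ` otherwise. -/
def smash (x : Fin n → OnePoint ℝ) : Sphere n :=
  open scoped Classical in
  if ∃ j, x j = ∞ then ∞ else ((fun j => (x j).elim 0 id : Fin n → ℝ) : OnePoint (Fin n → ℝ))

/-- The homeomorphism of `S¹ = ℝ ∪ {∞}` with the unit circle in `ℂ`,
`t ↦ (it - 1) (it + 1)⁻¹` and `∞ ↦ 1`. -/
def cayley (t : OnePoint ℝ) : ℂ :=
  t.elim 1 fun s => (Complex.I * s - 1) * (Complex.I * s + 1)⁻¹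

/-- `ku_n = ku(Sⁿ, Sym(ℂⁿ))`. -/
abbrev ku (n : ℕ) : Type := KU (∞ : Sphere n) (SymC n)

/-- `σ [(V₁, x₁), …, (Vₖ, xₖ)] = [(σ_* V₁, σ x₁), …, (σ_* Vₖ, σ xₖ)]`. -/
instance : MulAction (Equiv.Perm (Fin n)) (ku n) where
  smul σ := KU.map ∞ (SymC.perm σ) (sphereAct σ) rfl
  one_smul := by
    rintro ⟨k, V, x⟩
    have h1 : V.map (SymC.perm 1) = V := by
      refine Subtype.ext (funext fun i => ?_)
      rw [SymC.perm_one]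
      exact Submodule.map_id _
    have h2 : (fun i => sphereAct 1 (x i)) = x := by
      funext i
      induction x i using OnePoint.rec <;> rfl
    change KU.mk ∞ (V.map (SymC.perm 1)) (fun i => sphereAct 1 (x i)) = KU.mk ∞ V x
    rw [h1, h2]
  mul_smul σ τ := by
    rintro ⟨k, V, x⟩
    have h1 : V.map (SymC.perm (σ * τ)) = (V.map (SymC.perm τ)).map (SymC.perm σ) := by
      refine Subtype.ext (funext fun i => ?_)
      rw [SymC.perm_mul]
      exact Submodule.map_comp _ _ _
    have h2 : (fun i => sphereAct (σ * τ) (x i)) = fun i => sphereAct σ (sphereAct τ (x i)) := by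
      funext i
      induction x i using OnePoint.rec with
      | infty => rfl
      | coe y =>
        change ((_ : Fin n → ℝ) : OnePoint (Fin n → ℝ)) = ((_ : Fin n → ℝ) : OnePoint (Fin n → ℝ))
        rw [mul_inv_rev]
        rfl
    change KU.mk ∞ (V.map (SymC.perm (σ * τ))) (fun i => sphereAct (σ * τ) (x i)) =
      KU.mk ∞ ((V.map (SymC.perm τ)).map (SymC.perm σ))
        (fun i => sphereAct σ (sphereAct τ (x i)))
    rw [h1, h2]

/-- The action `σ [(A₁, …, Aₙ)] = [(σ_* A_{σ⁻¹(1)} σ_*⁻¹, …, σ_* A_{σ⁻¹(n)} σ_*⁻¹)]`. -/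
instance : MulAction (Equiv.Perm (Fin n)) (CommQuot (SymC n) n) where
  smul σ := CommQuot.act (SymC.perm σ) σ
  one_smul := by
    rintro ⟨A⟩
    have h : A.act (SymC.perm 1) 1 = A := by
      refine Subtype.ext (funext fun i => Subtype.ext ?_)
      change SymC.perm 1 * (A.1 ((1 : Equiv.Perm (Fin n))⁻¹ i)).1 * (SymC.perm 1)⁻¹ = (A.1 i).1
      rw [SymC.perm_one, inv_one, inv_one, one_mul, mul_one]
      rfl
    change CommQuot.mk (A.act (SymC.perm 1) 1) = CommQuot.mk A
    rw [h]
  mul_smul σ τ := by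
    rintro ⟨A⟩
    have h : A.act (SymC.perm (σ * τ)) (σ * τ) = (A.act (SymC.perm τ) τ).act (SymC.perm σ) σ := by
      refine Subtype.ext (funext fun i => Subtype.ext ?_)
      change SymC.perm (σ * τ) * (A.1 ((σ * τ)⁻¹ i)).1 * (SymC.perm (σ * τ))⁻¹ =
        SymC.perm σ * (SymC.perm τ * (A.1 (τ⁻¹ (σ⁻¹ i))).1 * (SymC.perm τ)⁻¹) * (SymC.perm σ)⁻¹
      rw [SymC.perm_mul, mul_inv_rev, mul_inv_rev, Equiv.Perm.mul_apply]
      simp only [mul_assoc]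
    change CommQuot.mk (A.act (SymC.perm (σ * τ)) (σ * τ)) =
      CommQuot.mk ((A.act (SymC.perm τ) τ).act (SymC.perm σ) σ)
    rw [h]

/-- The space `𝒞̄_n`: by convention it is `S⁰` for `n = 0`, and it is the quotient
`C_n(U(Sym(ℂⁿ))) / ∼` for `n ≥ 1`. -/
def CBar : ℕ → Type
  | 0 => Sphere 0
  | n + 1 => CommQuot (SymC (n + 1)) (n + 1)

instance : (n : ℕ) → TopologicalSpace (CBar n)
  | 0 => inferInstanceAs (TopologicalSpace (Sphere 0))
  | n + 1 => inferInstanceAs (TopologicalSpace (CommQuot (SymC (n + 1)) (n + 1)))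

/-- The `Σ_n`-action on `𝒞̄_n`; the trivial group `Σ_0` acts trivially on `S⁰`. -/
instance : (n : ℕ) → MulAction (Equiv.Perm (Fin n)) (CBar n)
  | 0 => { smul := fun _ x => x, one_smul := fun _ => rfl, mul_smul := fun _ _ _ => rfl }
  | n + 1 =>
    inferInstanceAs (MulAction (Equiv.Perm (Fin (n + 1))) (CommQuot (SymC (n + 1)) (n + 1)))

/-- The class `[(A₁, …, Aₙ)]` in `𝒞̄_n`, for `n ≥ 1`. -/
def CBar.mk : {n : ℕ} → n ≠ 0 → CommTuple (SymC n) n → CBar n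
  | 0, h, _ => absurd rfl h
  | _ + 1, _, A => CommQuot.mk A

/-- The basepoint of `𝒞̄_n`: the class of `(Id, …, Id)` for `n ≥ 1`, and `∞ ∈ S⁰` for `n = 0`. -/
def CBar.base : (n : ℕ) → CBar n
  | 0 => (∞ : Sphere 0)
  | n + 1 => CBar.mk n.succ_ne_zero ⟨fun _ => 1, fun _ _ => rfl⟩

end Spaces

end KuModel

end

/-! Commuting unitaries that are the identity off a finite dimensional subspace are simultaneously
diagonalizable (`exists_eq_diagTuple`), so a commuting `n`-tuple amounts to a finite orthogonal
decomposition into joint eigenspaces, indexed by points of `(S¹)ⁿ`. The relation `∼` forgets every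
eigenspace with some eigenvalue `1`: together these make up the sum of the fixed spaces. What
survives are the eigenspaces whose eigenvalues all differ from `1`, and the Cayley transform
identifies such eigenvalue tuples with points of `ℝⁿ = Sⁿ \ {∞}`. On the other side, a configuration
is determined by its labels at the points other than `∞` (`KU.label_injective`). So both spaces
record the same data: `eigen_cayleyTuple` matches labels with eigenspaces, and `config_eq_iff`
extracts from this both that the comparison map is well defined and that it is injective.

For the topology, both spaces are probed by the same compact spaces, whose points are an orthonormal
frame in a finite dimensional `V` together with parameters in `(S¹)ⁿ`; they map to configurations by
`config` and to tuples by `cayleyTuple`. Continuity of the comparison map is tested on these probes.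
Its inverse is continuous because the map is closed: for a closed set of configurations, the
corresponding commuting tuples supported on `V` form the image of a closed subset of a compact
probe. It suffices to see this for an increasing sequence of `V`, because the topology of `U(U)^n`
is determined by the compact subsets `U(V m)^n`. For one factor this comes from the colimit
topology; for the product it is the fact that finite powers of Hausdorff `k_ω`-spaces are `k_ω`
(`IsKOmega.pi`). The sequence exists since `Sym(ℂⁿ)` has a countable basis.

For `n = 0` the space `Sym(ℂ⁰)` is a line, so a configuration on `S⁰` is only the choice between the
label zero and the whole line. -/

noncomputable section

namespace KuModel

/-! ### Finite powers of `k_ω`-spaces -/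

section KOmega

open Filter Topology Set

/-- The tube lemma for finite products. -/
theorem pi_tube_lemma {ι X : Type*} [Finite ι] [TopologicalSpace X] {K : ι → Set X}
    (hK : ∀ i, IsCompact (K i)) {W : Set (ι → X)} (hW : IsOpen W) (h : univ.pi K ⊆ W) :
    ∃ O : ι → Set X, (∀ i, IsOpen (O i) ∧ K i ⊆ O i) ∧ univ.pi O ⊆ W := by
  have hmem : W ∈ Filter.pi fun i => 𝓝ˢ (K i) := by
    by_contra hcon
    have hne : NeBot ((Filter.pi fun i => 𝓝ˢ (K i)) ⊓ 𝓟 Wᶜ) := by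
      rwa [← mem_iff_inf_principal_compl.not.trans Filter.neBot_iff.symm]
    -- An ultrafilter avoiding `W` whose `i`-th projection is finer than `𝓝ˢ (K i)` converges,
    -- coordinate by coordinate and by compactness, to a point of the product of the `K i`, which
    -- lies in `W`.
    let u := Ultrafilter.of ((Filter.pi fun i => 𝓝ˢ (K i)) ⊓ 𝓟 Wᶜ)
    have hu : (u : Filter (ι → X)) ≤ (Filter.pi fun i => 𝓝ˢ (K i)) ⊓ 𝓟 Wᶜ := Ultrafilter.of_le _
    have hlim : ∀ i, ∃ a ∈ K i, ((u.map (Function.eval i) : Ultrafilter X) : Filter X) ≤ 𝓝 a := by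
      intro i
      have h1 : ((u.map (Function.eval i) : Ultrafilter X) : Filter X) ≤ 𝓝ˢ (K i) :=
        (tendsto_eval_pi (fun i => 𝓝ˢ (K i)) i).mono_left (hu.trans inf_le_left)
      have h2 : ¬ Disjoint (𝓝ˢ (K i)) ((u.map (Function.eval i) : Ultrafilter X) : Filter X) :=
        fun hd => (u.map (Function.eval i)).neBot.ne (hd.eq_bot_of_ge h1)
      rw [(hK i).disjoint_nhdsSet_left] at h2
      push Not at h2
      obtain ⟨a, ha, h3⟩ := h2
      exact ⟨a, ha, Ultrafilter.disjoint_iff_not_le.not_left.mp fun h => h3 h.symm⟩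
    choose a ha hlim using hlim
    have h4 : (u : Filter (ι → X)) ≤ 𝓝 a := tendsto_pi_nhds.mpr hlim
    have h5 : W ∈ u := h4 (hW.mem_nhds (h fun i _ => ha i))
    have h6 : Wᶜ ∈ u := (hu.trans inf_le_right) (mem_principal_self _)
    exact Ultrafilter.compl_mem_iff_notMem.mp h6 h5
  obtain ⟨S, hS, hSW⟩ := (Filter.mem_pi').mp hmem |> fun ⟨I, t, ht, hsub⟩ =>
    (⟨t, ht, (Set.pi_mono' (fun i _ => subset_rfl) (subset_univ _)).trans hsub⟩ :
      ∃ t : ι → Set X, (∀ i, t i ∈ 𝓝ˢ (K i)) ∧ univ.pi t ⊆ W)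
  refine ⟨fun i => interior (S i), fun i => ⟨isOpen_interior, ?_⟩, ?_⟩
  · exact subset_interior_iff_mem_nhdsSet.mpr (hS i)
  · exact (Set.pi_mono fun i _ => interior_subset).trans hSW

/-- The topology of `X` is determined by the increasing sequence of compact subsets `C`. -/
structure IsKOmega {X : Type*} [TopologicalSpace X] (C : ℕ → Set X) : Prop where
  mono : Monotone C
  isCompact : ∀ m, IsCompact (C m)
  exists_mem : ∀ x, ∃ m, x ∈ C m
  isClosed : ∀ S : Set X, (∀ m, IsClosed (S ∩ C m)) → IsClosed S

variable {X : Type*} [TopologicalSpace X] [T2Space X] {C : ℕ → Set X}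

/-- The sets `K m` need not be open, but on `C l` their union agrees with that of the open sets `P
m` for `m ≥ max m₀ l`: there `P m ∩ C l ⊆ K (m + 1)`, while `K m ⊆ P m`. Hence the complement of the
union is closed in every `C l`. -/
theorem IsKOmega.isOpen_iUnion (hC : IsKOmega C) {K P : ℕ → Set X} {m₀ : ℕ}
    (hKC : ∀ m, m₀ ≤ m → K m ⊆ C m) (hKP : ∀ m, K m ⊆ P m) (hP : ∀ m, IsOpen (P m))
    (hPK : ∀ m, m₀ ≤ m → P m ∩ C (m + 1) ⊆ K (m + 1)) : IsOpen (⋃ m ≥ m₀, K m) := by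
  have hmono : ∀ m m', m₀ ≤ m → m ≤ m' → K m ⊆ K m' := by
    intro m m' h0 h
    induction m', h using Nat.le_induction with
    | base => rfl
    | succ p hp ih =>
      exact fun x hx => hPK p (h0.trans hp) ⟨hKP p (ih hx),
        hC.mono (hp.trans p.le_succ) (hKC m h0 hx)⟩
  rw [← isClosed_compl_iff]
  refine hC.isClosed _ fun l => ?_
  have : (⋃ m ≥ m₀, K m)ᶜ ∩ C l = (⋃ m ≥ max m₀ l, P m)ᶜ ∩ C l := by
    ext x
    simp only [mem_inter_iff, mem_compl_iff, mem_iUnion, not_exists]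
    refine and_congr_left fun hx => ⟨fun h m hm hxm => ?_, fun h m hm hxm => ?_⟩
    · exact h (m + 1) ((le_max_left _ _).trans (hm.trans m.le_succ))
        (hPK m ((le_max_left _ _).trans hm)
          ⟨hxm, hC.mono ((le_max_right _ _).trans (hm.trans m.le_succ)) hx⟩)
    · exact h (max m l) (max_le_max_right l hm)
        (hKP _ (hmono m _ hm (le_max_left _ _) hxm))
  rw [this]
  exact (isClosed_compl_iff.mpr (isOpen_biUnion fun m _ => hP m)).inter (hC.isCompact l).isClosed

/-- The inductive step for growing a compact box away from `S`. The tube lemma provides room `O i`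
around `K i`; separating `K i` from the compact set `C m \ O i` by open sets `P i`, `Q i` leaves the
compact set `C m \ Q i` between `P i ∩ C m` and `O i`. -/
theorem IsKOmega.exists_step (hC : IsKOmega C) {ι : Type*} [Finite ι] {S : Set (ι → X)}
    (hS : ∀ m, IsClosed (S ∩ univ.pi fun _ => C m)) (m : ℕ) (K : ι → Set X)
    (hK : ∀ i, IsCompact (K i)) (hKS : Disjoint (univ.pi K) S) :
    ∃ K' P : ι → Set X, (∀ i, IsCompact (K' i) ∧ K' i ⊆ C m ∧ K i ⊆ P i ∧ IsOpen (P i) ∧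
      P i ∩ C m ⊆ K' i) ∧ Disjoint (univ.pi K') S := by
  obtain ⟨O, hO, hOW⟩ := pi_tube_lemma hK (hS m).isOpen_compl
    (fun x hx hx' => hKS.le_bot ⟨hx, hx'.1⟩)
  have hsep : ∀ i, SeparatedNhds (K i) (C m \ O i) := fun i =>
    SeparatedNhds.of_isCompact_isCompact (hK i) ((hC.isCompact m).diff (hO i).1)
      (disjoint_left.mpr fun x hx hx' => hx'.2 ((hO i).2 hx))
  choose P Q hP hQ hKP hCQ hPQ using hsep
  refine ⟨fun i => C m \ Q i, P, fun i => ⟨(hC.isCompact m).diff (hQ i), sdiff_subset, hKP i, hP i,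
    fun x hx => ⟨hx.2, fun hx' => (hPQ i).le_bot ⟨hx.1, hx'⟩⟩⟩, ?_⟩
  refine disjoint_left.mpr fun x hx hxS => hOW (a := x) (fun i hi => ?_)
    ⟨hxS, fun i hi => (hx i hi).1⟩
  by_contra hxO
  exact (hx i hi).2 (hCQ i ⟨(hx i hi).1, hxO⟩)

/-- Finite powers of `k_ω`-spaces are `k_ω`-spaces. -/
theorem IsKOmega.pi (hC : IsKOmega C) (ι : Type*) [Finite ι] :
    IsKOmega fun m => (univ.pi fun _ : ι => C m) where
  mono _ _ h := Set.pi_mono fun _ _ => hC.mono h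
  isCompact m := isCompact_univ_pi fun _ => hC.isCompact m
  exists_mem x := by
    choose m hm using fun i => hC.exists_mem (x i)
    obtain ⟨M, hM⟩ := (Set.finite_range m).bddAbove
    exact ⟨M, fun i _ => hC.mono (hM ⟨i, rfl⟩) (hm i)⟩
  isClosed S hS := by
    rw [← isOpen_compl_iff, isOpen_iff_mem_nhds]
    intro a ha
    obtain ⟨m₀, hm₀⟩ : ∃ m, ∀ i, a i ∈ C m := by
      choose m hm using fun i => hC.exists_mem (a i)
      obtain ⟨M, hM⟩ := (Set.finite_range m).bddAbove
      exact ⟨M, fun i => hC.mono (hM ⟨i, rfl⟩) (hm i)⟩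
    let T : Type _ := {K : ι → Set X // (∀ i, IsCompact (K i)) ∧ Disjoint (univ.pi K) S}
    have hstep : ∀ (m : ℕ) (K : T), ∃ K' : T, ∃ P : ι → Set X, ∀ i, K'.1 i ⊆ C m ∧
        K.1 i ⊆ P i ∧ IsOpen (P i) ∧ P i ∩ C m ⊆ K'.1 i := by
      intro m K
      obtain ⟨K', P, h1, h2⟩ := hC.exists_step hS m K.1 K.2.1 K.2.2
      exact ⟨⟨K', fun i => (h1 i).1, h2⟩, P, fun i => (h1 i).2⟩
    choose next P hnext using hstep
    let K₀ : T := ⟨fun i => {a i}, fun _ => isCompact_singleton,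
      disjoint_left.mpr fun x hx hxS => by
        have : x = a := funext fun i => hx i (mem_univ i)
        exact ha (this ▸ hxS)⟩
    -- The box at stage `p` lies in `C (m₀ + p)`, starting from the point `a` itself; the next box
    -- therefore lives at level `m₀ + q + 1`.
    let K : ℕ → T := fun p => Nat.rec K₀ (fun q L => next (m₀ + q + 1) L) p
    have hKC : ∀ p i, (K p).1 i ⊆ C (m₀ + p) := by
      rintro (_ | p) i
      · exact singleton_subset_iff.mpr (hm₀ i)
      · exact (hnext (m₀ + p + 1) (K p) i).1
    have hC' : IsKOmega fun p => C (m₀ + p) :=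
      ⟨fun p q h => hC.mono (Nat.add_le_add_left h m₀), fun p => hC.isCompact _,
        fun x => (hC.exists_mem x).imp fun m hm => hC.mono (Nat.le_add_left m m₀) hm,
        fun S hS => hC.isClosed S fun m => by
          have := (hS m).inter (hC.isCompact m).isClosed
          rwa [inter_assoc, inter_eq_self_of_subset_right
            (hC.mono (Nat.le_add_left m m₀))] at this⟩
    have hopen : ∀ i, IsOpen (⋃ p ≥ 0, (K p).1 i) := fun i =>
      hC'.isOpen_iUnion (P := fun p => P (m₀ + p + 1) (K p) i) (fun p _ => hKC p i)
        (fun p => (hnext (m₀ + p + 1) (K p) i).2.1)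
        (fun p => (hnext (m₀ + p + 1) (K p) i).2.2.1)
        (fun p _ => (hnext (m₀ + p + 1) (K p) i).2.2.2)
    have hmono : ∀ i, Monotone fun p => (K p).1 i := fun i =>
      monotone_nat_of_le_succ fun p x hx => (hnext (m₀ + p + 1) (K p) i).2.2.2
        ⟨(hnext (m₀ + p + 1) (K p) i).2.1 hx, hC.mono (Nat.le_succ _) (hKC p i hx)⟩
    refine Filter.mem_of_superset ((isOpen_set_pi finite_univ fun i _ => hopen i).mem_nhds
      (x := a) fun i _ => mem_iUnion₂.mpr ⟨0, le_rfl, rfl⟩) fun x hx hxS => ?_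
    -- The boxes increase and there are finitely many coordinates, so a point of the product of the
    -- unions already lies in a single box, which misses `S`.
    have hx' : ∀ i, ∃ p, x i ∈ (K p).1 i := fun i => by
      obtain ⟨p, _, hp⟩ := mem_iUnion₂.mp (hx i (mem_univ i))
      exact ⟨p, hp⟩
    choose p hp using hx'
    obtain ⟨M, hM⟩ := (Set.finite_range p).bddAbove
    exact (K M).2.2.le_bot ⟨fun i _ => hmono i (hM ⟨i, rfl⟩) (hp i), hxS⟩

end KOmega

/-! ### The labels of a configuration -/

section Support

variable {X : Type} {pt : X} {U : Type} [NormedAddCommGroup U] [InnerProductSpace ℂ U]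

/-- The sum of the labels `V i` of the points `x i` that are equal to `s`. -/
def labelSum {k : ℕ} (V : Fin k → Submodule ℂ U) (x : Fin k → X) (s : X) : Submodule ℂ U :=
  ⨆ i : {i : Fin k // x i = s}, V i

theorem le_labelSum {k : ℕ} (V : Fin k → Submodule ℂ U) {x : Fin k → X} {s : X} {i : Fin k}
    (h : x i = s) : V i ≤ labelSum V x s :=
  le_iSup (fun i : {i : Fin k // x i = s} => V i) ⟨i, h⟩

theorem labelSum_le {k : ℕ} {V : Fin k → Submodule ℂ U} {x : Fin k → X} {s : X}
    {S : Submodule ℂ U} (h : ∀ i, x i = s → V i ≤ S) : labelSum V x s ≤ S :=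
  iSup_le fun i => h i i.2

/-- Entries dropped by `α` are exactly those that the pulled back points place at `pt`, so they do
not contribute to a label at `s ≠ pt`. This makes labels descend to the coend. -/
theorem labelSum_push {k l : ℕ} (α : Fin (k + 1) → Fin (l + 1)) (V : OrthTuple U k)
    (x : Fin l → X) {s : X} (hs : s ≠ pt) :
    labelSum (V.push α).1 x s = labelSum V.1 (pull pt α x) s := by
  refine le_antisymm (labelSum_le fun i hi => iSup_le fun j => ?_) (labelSum_le fun j hj => ?_)
  · refine le_labelSum V.1 ?_
    rw [pull, j.2, Fin.cons_succ, hi]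
  · obtain ⟨i, hi⟩ : ∃ i, α j.succ = Fin.succ i := by
      refine (Fin.eq_zero_or_eq_succ (α j.succ)).resolve_left fun h => hs ?_
      rw [← hj, pull, h, Fin.cons_zero]
    rw [pull, hi, Fin.cons_succ] at hj
    refine le_trans ?_ (le_labelSum (V.push α).1 hj)
    exact le_iSup (fun j : {j : Fin k // α j.succ = i.succ} => V.1 j) ⟨j, hi⟩

/-- The sum of the labels of all the points of a configuration that are equal to `s ≠ pt`. -/
def KU.label (c : KU pt U) (s : {s : X // s ≠ pt}) : Submodule ℂ U :=
  Quot.lift (fun p : Labelled X U => labelSum p.2.1.1 p.2.2 s) (by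
    rintro _ _ ⟨α, hα, V, x⟩
    exact labelSum_push α V x s.2) c

theorem KU.label_mk {k : ℕ} (V : OrthTuple U k) (x : Fin k → X) (s : {s : X // s ≠ pt}) :
    (KU.mk pt V x).label s = labelSum V.1 x s := rfl

open scoped Classical in
/-- A configuration only depends on its labels. -/
theorem KU.mk_eq_pushforward {k l : ℕ} (V : OrthTuple U k) (x : Fin k → X)
    (y : Fin l → X) (hy : Function.Injective y) (hpt : ∀ i, y i ≠ pt)
    (hxy : ∀ j, x j ≠ pt → ∃ i, y i = x j) :
    ∃ W : OrthTuple U l, (∀ i, W.1 i = (KU.mk pt V x).label ⟨y i, hpt i⟩) ∧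
      KU.mk pt V x = KU.mk pt W y := by
  -- `β` sends `j` to the position of `x j` in the list `y`, and to the basepoint `0` if `x j = pt`;
  -- so `x` is the pullback of `y`, and one gluing relation suffices.
  let β : Fin k → Fin (l + 1) := fun j =>
    if h : x j ≠ pt then (hxy j h).choose.succ else 0
  have hβ : ∀ j, x j ≠ pt → ∃ i, β j = Fin.succ i ∧ y i = x j := fun j h =>
    ⟨(hxy j h).choose, dif_pos h, (hxy j h).choose_spec⟩
  have hβ' : ∀ j i, β j = Fin.succ i ↔ x j = y i := by
    intro j i
    by_cases h : x j = pt
    · refine ⟨fun h' => ?_, fun h' => absurd (h'.symm.trans h) (hpt i)⟩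
      rw [show β j = 0 from dif_neg (not_not.mpr h)] at h'
      exact absurd h'.symm (Fin.succ_ne_zero i)
    · obtain ⟨i', h1, h2⟩ := hβ j h
      rw [h1, ← h2, hy.eq_iff, Fin.succ_inj]
  let α : Fin (k + 1) → Fin (l + 1) := Fin.cons 0 β
  have hα : ∀ j : Fin k, α j.succ = β j := fun j => Fin.cons_succ _ _ _
  refine ⟨V.push α, fun i => ?_, ?_⟩
  · have hs : ∀ j : Fin k, α j.succ = i.succ ↔ x j = y i := fun j => hα j ▸ hβ' j i
    exact (Equiv.subtypeEquivRight hs).iSup_congr fun _ => rfl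
  · have hx : pull pt α y = x := by
      funext j
      simp only [pull, hα]
      by_cases h : x j = pt
      · rw [show β j = 0 from dif_neg (not_not.mpr h), Fin.cons_zero, h]
      · obtain ⟨i, h1, h2⟩ := hβ j h
        rw [h1, Fin.cons_succ, h2]
    have := Quot.sound (CoendRel.glue (pt := pt) α (Fin.cons_zero _ _) V y)
    rw [hx] at this
    exact this.symm

/-- Two configurations can be rewritten over one common injective list of points different from
`pt`; the label tuples over this list are then the values of `label`. -/
theorem KU.label_injective : Function.Injective (KU.label : KU pt U → _ → Submodule ℂ U) := by
  classical
  rintro ⟨k, V, x⟩ ⟨k', V', x'⟩ h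
  change (KU.mk pt V x).label = (KU.mk pt V' x').label at h
  change KU.mk pt V x = KU.mk pt V' x'
  let T : Finset X := (Finset.univ.image x ∪ Finset.univ.image x').erase pt
  let y : Fin T.card → X := fun i => T.equivFin.symm i
  have hy : Function.Injective y := Subtype.val_injective.comp T.equivFin.symm.injective
  have hpt : ∀ i, y i ≠ pt := fun i => Finset.ne_of_mem_erase (T.equivFin.symm i).2
  have hT : ∀ s ∈ T, ∃ i, y i = s := fun s hs =>
    ⟨T.equivFin ⟨s, hs⟩, by simp only [y, Equiv.symm_apply_apply]⟩
  obtain ⟨W, hW, e⟩ := KU.mk_eq_pushforward (pt := pt) V x y hy hpt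
    fun j hj => hT _ (by simp [T, hj])
  obtain ⟨W', hW', e'⟩ := KU.mk_eq_pushforward (pt := pt) V' x' y hy hpt
    fun j hj => hT _ (by simp [T, hj])
  have : W = W' := Subtype.ext (funext fun i => by rw [hW, hW', h])
  rw [e, e', this]

theorem KU.label_base (s : {s : X // s ≠ pt}) : (KU.base pt U).label s = ⊥ := by
  exact le_bot_iff.mp (labelSum_le fun _ _ => le_rfl)

end Support

/-! ### Unitaries that are diagonal in a finite orthonormal family -/

section Diag

variable {U : Type} [NormedAddCommGroup U] [InnerProductSpace ℂ U]
variable {ι : Type} [Fintype ι] [DecidableEq ι]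

/-- The linear map with eigenvalues `w a` on the vectors `f (e_a)`,
and the identity on their orthogonal complement. -/
def diagLin (f : EuclideanSpace ℂ ι →ₗᵢ[ℂ] U) (w : ι → ℂ) : U →ₗ[ℂ] U :=
  LinearMap.id + ∑ a, (w a - 1) • (innerₛₗ ℂ (f (EuclideanSpace.single a 1))).smulRight
    (f (EuclideanSpace.single a 1))

variable (f : EuclideanSpace ℂ ι →ₗᵢ[ℂ] U)

theorem diagLin_apply (w : ι → ℂ) (x : U) :
    diagLin f w x = x + ∑ a, ((w a - 1) * inner ℂ (f (EuclideanSpace.single a 1)) x) •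
      f (EuclideanSpace.single a 1) := by
  simp [diagLin, smul_smul]

theorem inner_basis (a b : ι) : inner ℂ (f (EuclideanSpace.single a 1))
    (f (EuclideanSpace.single b 1)) = if a = b then (1 : ℂ) else 0 := by
  rw [LinearIsometry.inner_map_map, EuclideanSpace.inner_single_left]
  simp

theorem diagLin_basis (w : ι → ℂ) (a : ι) :
    diagLin f w (f (EuclideanSpace.single a 1)) = w a • f (EuclideanSpace.single a 1) := by
  rw [diagLin_apply, Finset.sum_eq_single a]
  · rw [inner_basis, if_pos rfl, mul_one, sub_smul, one_smul, add_sub_cancel]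
  · intro b _ hb
    rw [inner_basis, if_neg hb, mul_zero, zero_smul]
  · simp

theorem inner_diagLin (w : ι → ℂ) (a : ι) (x : U) :
    inner ℂ (f (EuclideanSpace.single a 1)) (diagLin f w x) =
      w a * inner ℂ (f (EuclideanSpace.single a 1)) x := by
  rw [diagLin_apply, inner_add_right, inner_sum, Finset.sum_eq_single a]
  · rw [inner_smul_right, inner_basis, if_pos rfl]
    ring
  · intro b _ hb
    rw [inner_smul_right, inner_basis, if_neg hb.symm, mul_zero]
  · simp

theorem diagLin_diagLin (w w' : ι → ℂ) (x : U) :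
    diagLin f w (diagLin f w' x) = diagLin f (w * w') x := by
  rw [diagLin_apply]
  simp only [inner_diagLin]
  rw [diagLin_apply f w', diagLin_apply f (w * w'), add_assoc, ← Finset.sum_add_distrib]
  congr 1
  refine Finset.sum_congr rfl fun a _ => ?_
  rw [← add_smul, Pi.mul_apply]
  congr 1
  ring

theorem diagLin_one (x : U) : diagLin f 1 x = x := by
  simp [diagLin_apply]

theorem inner_diagLin_diagLin (w : ι → Circle) (x y : U) :
    inner ℂ (diagLin f (fun a => (w a : ℂ)) x) (diagLin f (fun a => (w a : ℂ)) y) =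
      inner ℂ x y := by
  rw [diagLin_apply f _ x, inner_add_left, sum_inner]
  simp only [inner_smul_left, inner_diagLin]
  rw [diagLin_apply, inner_add_right, inner_sum, add_assoc, ← Finset.sum_add_distrib,
    add_eq_left]
  -- Up to a common factor the `a`-th term is `(w - 1) + (w̄ - 1) w = w̄ w - 1`, with `w = w a`.
  refine Finset.sum_eq_zero fun a _ => ?_
  have h : (starRingEnd ℂ (w a : ℂ)) * (w a : ℂ) = 1 := by
    rw [← Complex.normSq_eq_conj_mul_self, Circle.normSq_coe, Complex.ofReal_one]
  rw [inner_smul_right, map_mul, map_sub, map_one, inner_conj_symm]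
  linear_combination (inner ℂ x (f (EuclideanSpace.single a 1))) *
    (inner ℂ (f (EuclideanSpace.single a 1)) y) * h

/-- The unitary with eigenvalues `w a` on the vectors `f (e_a)`,
and the identity on their orthogonal complement. -/
def diagIso (w : ι → Circle) : U ≃ₗᵢ[ℂ] U :=
  LinearEquiv.isometryOfInner
    { diagLin f (fun a => (w a : ℂ)) with
      invFun := diagLin f (fun a => ((w⁻¹) a : ℂ))
      left_inv := fun x => by
        refine (diagLin_diagLin f _ _ x).trans (Eq.trans ?_ (diagLin_one f x))
        exact congrArg (fun w => diagLin f w x) (funext fun a => by simp)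
      right_inv := fun x => by
        refine (diagLin_diagLin f _ _ x).trans (Eq.trans ?_ (diagLin_one f x))
        exact congrArg (fun w => diagLin f w x) (funext fun a => by simp) }
    (inner_diagLin_diagLin f w)

theorem diagIso_apply (w : ι → Circle) (x : U) :
    diagIso f w x = diagLin f (fun a => (w a : ℂ)) x := rfl

theorem diagIso_basis (w : ι → Circle) (a : ι) : diagIso f w (f (EuclideanSpace.single a 1)) =
    (w a : ℂ) • f (EuclideanSpace.single a 1) := diagLin_basis f _ a

theorem diagIso_of_inner_eq_zero (w : ι → Circle) {x : U}
    (hx : ∀ a, inner ℂ (f (EuclideanSpace.single a 1)) x = (0 : ℂ)) : diagIso f w x = x := by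
  rw [diagIso_apply, diagLin_apply]
  simp [hx]

theorem diagIso_mem (w : ι → Circle) : diagIso f w ∈ stableUnitary U :=
  ⟨LinearMap.range f.toLinearMap, inferInstance, fun _ hx => diagIso_of_inner_eq_zero f w fun a =>
    hx _ ⟨EuclideanSpace.single a 1, rfl⟩⟩

/-- The commuting tuple that is diagonal in the orthonormal family `f (e_a)`. -/
def diagTuple {n : ℕ} (w : ι → Fin n → Circle) : CommTuple U n :=
  ⟨fun j => ⟨diagIso f fun a => w a j, diagIso_mem f _⟩, fun i j => Subtype.ext
    (LinearIsometryEquiv.ext fun x => by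
      change diagLin f _ (diagLin f _ x) = diagLin f _ (diagLin f _ x)
      rw [diagLin_diagLin, diagLin_diagLin, mul_comm])⟩

theorem diagTuple_coe {n : ℕ} (w : ι → Fin n → Circle) (j : Fin n) :
    ((diagTuple f w).1 j).1 = diagIso f fun a => w a j := rfl

/-- Every vector is the sum of its components along the vectors `f (e_a)` and of a vector that is
orthogonal to them. -/
theorem exists_eq_sum_add (x : U) : ∃ r : U,
    (∀ a, inner ℂ (f (EuclideanSpace.single a 1)) r = (0 : ℂ)) ∧
    x = (∑ a, (inner ℂ (f (EuclideanSpace.single a 1)) x : ℂ) • f (EuclideanSpace.single a 1)) +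
      r := by
  -- With all eigenvalues `0`, `diagLin` is the projection onto the orthogonal complement of the
  -- family.
  refine ⟨diagLin f 0 x, fun a => ?_, ?_⟩
  · rw [inner_diagLin, Pi.zero_apply, zero_mul]
  · rw [diagLin_apply]
    simp [add_comm x]

end Diag

/-! ### Joint eigenspaces -/

section Eigen

variable {U : Type} [NormedAddCommGroup U] [InnerProductSpace ℂ U] {n : ℕ}

/-- The joint eigenspace of a commuting tuple for the eigenvalues `z`. -/
def CommTuple.eigen (A : CommTuple U n) (z : Fin n → Circle) : Submodule ℂ U where
  carrier := {x | ∀ j, (A.1 j).1 x = (z j : ℂ) • x}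
  add_mem' hx hy j := by rw [map_add, hx j, hy j, smul_add]
  zero_mem' j := by rw [map_zero, smul_zero]
  smul_mem' c x hx j := by rw [map_smul, hx j, smul_comm]

/-- Isometry gives `z̄ w ⟨x, y⟩ = ⟨x, y⟩`; multiplying by `z` turns this into `(w - z) ⟨x, y⟩ = 0`.
-/
theorem inner_eq_zero_of_eigenvalue_ne (A : U ≃ₗᵢ[ℂ] U) {z w : Circle} (h : z ≠ w) {x y : U}
    (hx : A x = (z : ℂ) • x) (hy : A y = (w : ℂ) • y) : inner ℂ x y = (0 : ℂ) := by
  have h1 := A.inner_map_map x y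
  rw [hx, hy, inner_smul_left, inner_smul_right] at h1
  have h2 : (starRingEnd ℂ (z : ℂ)) * (z : ℂ) = 1 := by
    rw [← Complex.normSq_eq_conj_mul_self, Circle.normSq_coe, Complex.ofReal_one]
  have h3 : ((w : ℂ) - z) * inner ℂ x y = 0 := by
    linear_combination (z : ℂ) * h1 - (w : ℂ) * (inner ℂ x y) * h2
  refine (mul_eq_zero.mp h3).resolve_left fun h4 => h ?_
  exact (Circle.ext (sub_eq_zero.mp h4)).symm

/-- Such an eigenvector is orthogonal to the fixed space of every single `A j`, hence lies where `∼`
still sees the tuple. This makes these eigenspaces invariants of the class. -/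
theorem CommTuple.eigen_le_orthogonal (A : CommTuple U n) {z : Fin n → Circle}
    (hz : ∀ j, z j ≠ 1) : A.eigen z ≤ A.fixedSumᗮ := by
  intro x hx
  rw [fixedSum, ← Submodule.iInf_orthogonal, Submodule.mem_iInf]
  intro j y hy
  have hy : (A.1 j).1 y = ((1 : Circle) : ℂ) • y := by
    rw [Circle.coe_one, one_smul]
    exact sub_eq_zero.mp hy
  exact inner_eq_zero_of_eigenvalue_ne (A.1 j).1 (hz j).symm hy (hx j)

theorem CommTuple.eigen_eq_of_rel {A B : CommTuple U n} (h : commSetoid U n A B)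
    {z : Fin n → Circle} (hz : ∀ j, z j ≠ 1) : A.eigen z = B.eigen z := by
  refine le_antisymm (fun x hx j => ?_) (fun x hx j => ?_)
  · rw [← h.2 j x (A.eigen_le_orthogonal hz hx), hx j]
  · rw [h.2 j x (h.1 ▸ B.eigen_le_orthogonal hz hx), hx j]

variable {ι : Type} [Fintype ι] [DecidableEq ι]

/-- The component of `x` orthogonal to the family is fixed by every unitary of the tuple, so it is
orthogonal to `x` as soon as one coordinate `z j ≠ 1` exists, whence it vanishes; the components
along vectors with `w a ≠ z` vanish by orthogonality of eigenspaces. -/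
theorem eigen_diagTuple (f : EuclideanSpace ℂ ι →ₗᵢ[ℂ] U) (w : ι → Fin n → Circle)
    (hn : n ≠ 0) {z : Fin n → Circle} (hz : ∀ j, z j ≠ 1) : (diagTuple f w).eigen z =
      Submodule.span ℂ ((fun a => f (EuclideanSpace.single a 1)) '' {a | w a = z}) := by
  refine le_antisymm (fun x hx => ?_) (Submodule.span_le.mpr ?_)
  · obtain ⟨r, hr, hxr⟩ := exists_eq_sum_add f x
    have hrx : inner ℂ r x = (0 : ℂ) := by
      obtain ⟨j⟩ : Nonempty (Fin n) := Fin.pos_iff_nonempty.mp (Nat.pos_of_ne_zero hn)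
      refine inner_eq_zero_of_eigenvalue_ne ((diagTuple f w).1 j).1 (hz j).symm ?_ (hx j)
      rw [Circle.coe_one, one_smul]
      exact diagIso_of_inner_eq_zero f _ hr
    have hr0 : r = 0 := by
      rw [← inner_self_eq_zero (𝕜 := ℂ)]
      rw [hxr, inner_add_right, inner_sum, Finset.sum_eq_zero, zero_add] at hrx
      · exact hrx
      · intro a _
        rw [inner_smul_right, ← inner_conj_symm r, hr, map_zero, mul_zero]
    rw [hxr, hr0, add_zero]
    refine Submodule.sum_mem _ fun a _ => ?_
    by_cases ha : w a = z
    · exact Submodule.smul_mem _ _ (Submodule.subset_span ⟨a, ha, rfl⟩)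
    · obtain ⟨j, hj⟩ := Function.ne_iff.mp ha
      rw [inner_eq_zero_of_eigenvalue_ne ((diagTuple f w).1 j).1 hj
        (diagIso_basis f _ a) (hx j), zero_smul]
      exact zero_mem _
  · rintro _ ⟨a, rfl, rfl⟩ j
    exact diagIso_basis f _ a

/-- A vector of the family either has all eigenvalues different from `1`, and then does not occur in
a vector of the right-hand side, or it is fixed by some member of the tuple. The remainder is fixed
by all members. -/
theorem fixedSum_diagTuple (f : EuclideanSpace ℂ ι →ₗᵢ[ℂ] U) (w : ι → Fin n → Circle)
    (hn : n ≠ 0) : (diagTuple f w).fixedSum =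
      (⨆ z : {z : Fin n → Circle // ∀ j, z j ≠ 1}, (diagTuple f w).eigen z)ᗮ := by
  refine le_antisymm ?_ fun x hx => ?_
  · refine (Submodule.le_orthogonal_orthogonal _).trans (Submodule.orthogonal_le ?_)
    exact iSup_le fun z => CommTuple.eigen_le_orthogonal _ z.2
  · obtain ⟨r, hr, hxr⟩ := exists_eq_sum_add f x
    rw [hxr]
    refine add_mem (Submodule.sum_mem _ fun a _ => ?_) ?_
    · by_cases ha : ∀ j, w a j ≠ 1
      · rw [hx _ (Submodule.mem_iSup_of_mem ⟨w a, ha⟩ fun j => diagIso_basis f _ a), zero_smul]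
        exact zero_mem _
      · push Not at ha
        obtain ⟨j, hj⟩ := ha
        refine Submodule.smul_mem _ _ (Submodule.mem_iSup_of_mem j ?_)
        refine sub_eq_zero.mpr ((diagIso_basis f _ a).trans ?_)
        rw [hj, Circle.coe_one, one_smul]
        rfl
    · obtain ⟨j⟩ : Nonempty (Fin n) := Fin.pos_iff_nonempty.mp (Nat.pos_of_ne_zero hn)
      exact Submodule.mem_iSup_of_mem j (sub_eq_zero.mpr (diagIso_of_inner_eq_zero f _ hr))

/-- Equivalence of tuples is detected by the joint eigenspaces for eigenvalues different
from `1`. -/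
theorem rel_of_eigen_eq {ι' : Type} [Fintype ι'] [DecidableEq ι']
    (f : EuclideanSpace ℂ ι →ₗᵢ[ℂ] U) (w : ι → Fin n → Circle)
    (f' : EuclideanSpace ℂ ι' →ₗᵢ[ℂ] U) (w' : ι' → Fin n → Circle) (hn : n ≠ 0)
    (h : ∀ z : Fin n → Circle, (∀ j, z j ≠ 1) →
      (diagTuple f w).eigen z = (diagTuple f' w').eigen z) :
    commSetoid U n (diagTuple f w) (diagTuple f' w') := by
  have hG : (⨆ z : {z : Fin n → Circle // ∀ j, z j ≠ 1}, (diagTuple f w).eigen z) =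
      ⨆ z : {z : Fin n → Circle // ∀ j, z j ≠ 1}, (diagTuple f' w').eigen z :=
    iSup_congr fun z => h z z.2
  refine ⟨by rw [fixedSum_diagTuple f w hn, fixedSum_diagTuple f' w' hn, hG], fun j x hx => ?_⟩
  -- `U` need not be complete; finite dimensionality is what identifies this sum with its double
  -- orthogonal complement.
  have hfin : FiniteDimensional ℂ
      (⨆ z : {z : Fin n → Circle // ∀ j, z j ≠ 1}, (diagTuple f w).eigen z : Submodule ℂ U) := by
    refine Submodule.finiteDimensional_of_le (S₂ := LinearMap.range f.toLinearMap)
      (iSup_le fun z => ?_)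
    rw [eigen_diagTuple f w hn z.2, Submodule.span_le]
    rintro _ ⟨a, -, rfl⟩
    exact ⟨_, rfl⟩
  rw [fixedSum_diagTuple f w hn, Submodule.orthogonal_orthogonal] at hx
  refine Submodule.iSup_induction _ (motive := fun x => ((diagTuple f w).1 j).1 x =
    ((diagTuple f' w').1 j).1 x) hx (fun z y hy => ?_) (by rw [map_zero, map_zero])
    (fun y y' hy hy' => by rw [map_add, map_add, hy, hy'])
  rw [hy j]
  rw [h z z.2] at hy
  rw [hy j]

end Eigen

/-! ### The Cayley transform and the smash product of circles -/

section Cayley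

open Filter Topology

theorem I_mul_add_one_ne_zero (s : ℝ) : Complex.I * s + 1 ≠ 0 := fun h => by
  simpa using congrArg Complex.re h

/-- In this form `s` occurs only once, which makes injectivity and the limit at infinity visible. -/
theorem cayley_coe (s : ℝ) : cayley s = 1 - 2 * (Complex.I * s + 1)⁻¹ := by
  change (Complex.I * s - 1) * (Complex.I * s + 1)⁻¹ = _
  have := I_mul_add_one_ne_zero s
  field_simp
  ring

theorem norm_cayley (t : OnePoint ℝ) : ‖cayley t‖ = 1 := by
  induction t using OnePoint.rec with
  | infty => exact norm_one
  | coe s =>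
    change ‖(Complex.I * s - 1) * (Complex.I * s + 1)⁻¹‖ = 1
    rw [norm_mul, norm_inv]
    have : ‖Complex.I * s - 1‖ = ‖Complex.I * s + 1‖ := by
      rw [← sq_eq_sq₀ (norm_nonneg _) (norm_nonneg _), ← Complex.normSq_eq_norm_sq,
        ← Complex.normSq_eq_norm_sq]
      simp [Complex.normSq_apply]
    rw [this]
    exact mul_inv_cancel₀ (norm_ne_zero_iff.mpr (I_mul_add_one_ne_zero s))

/-- The Cayley transform as a map to the unit circle. -/
def cayleyCircle (t : OnePoint ℝ) : Circle :=
  ⟨cayley t, mem_sphere_zero_iff_norm.mpr (norm_cayley t)⟩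

theorem coe_cayleyCircle (t : OnePoint ℝ) : (cayleyCircle t : ℂ) = cayley t := rfl

theorem cayleyCircle_infty : cayleyCircle ∞ = 1 := rfl

theorem cayleyCircle_coe_ne_one (s : ℝ) : cayleyCircle s ≠ 1 := fun h => by
  have h := congrArg (Subtype.val : Circle → ℂ) h
  change cayley s = 1 at h
  rw [cayley_coe, sub_eq_self] at h
  simp [I_mul_add_one_ne_zero s] at h

theorem cayleyCircle_injective : Function.Injective cayleyCircle := by
  intro t t' h
  induction t using OnePoint.rec with
  | infty =>
    induction t' using OnePoint.rec with
    | infty => rfl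
    | coe s' => exact absurd h.symm (cayleyCircle_coe_ne_one s')
  | coe s =>
    induction t' using OnePoint.rec with
    | infty => exact absurd h (cayleyCircle_coe_ne_one s)
    | coe s' =>
      have h := congrArg (Subtype.val : Circle → ℂ) h
      change cayley s = cayley s' at h
      rw [cayley_coe, cayley_coe, sub_right_inj] at h
      have h1 := inv_injective (mul_left_cancel₀ two_ne_zero h)
      have h2 : (s : ℂ) = s' := mul_left_cancel₀ Complex.I_ne_zero (add_right_cancel h1)
      rw [Complex.ofReal_inj.mp h2]

theorem cayleyCircle_surjective : Function.Surjective cayleyCircle := by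
  intro z
  by_cases hz : z = 1
  · exact ⟨∞, hz.symm⟩
  have hz' : (1 : ℂ) - z ≠ 0 := fun h => hz (Circle.ext (sub_eq_zero.mp h).symm)
  have h1 : (starRingEnd ℂ (z : ℂ)) * (z : ℂ) = 1 := by
    rw [← Complex.normSq_eq_conj_mul_self, Circle.normSq_coe, Complex.ofReal_one]
  -- The solution of `z = 1 - 2 / (i u + 1)`; it is real because `z̄ z = 1`.
  let u : ℂ := -Complex.I * ((1 + z) / (1 - z))
  have hu : starRingEnd ℂ u = u := by
    have h0 : (z : ℂ) ≠ 0 := z.coe_ne_zero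
    have hz2 : (1 : ℂ) - starRingEnd ℂ (z : ℂ) ≠ 0 := fun h => hz' (by
      have := congrArg (starRingEnd ℂ) h
      simpa using this)
    simp only [u, map_mul, map_neg, Complex.conj_I, map_div₀, map_add, map_sub, map_one]
    rw [neg_neg, mul_div_assoc', mul_div_assoc', div_eq_div_iff hz2 hz']
    linear_combination (-2 * Complex.I) * h1
  obtain ⟨s, hs⟩ := Complex.conj_eq_iff_real.mp hu
  refine ⟨s, Circle.ext ?_⟩
  rw [coe_cayleyCircle, cayley_coe, ← hs]
  have : Complex.I * u + 1 = 2 * (1 - (z : ℂ))⁻¹ := by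
    simp only [u]
    field_simp
    rw [Complex.I_sq]
    ring
  rw [this]
  field_simp
  ring

theorem continuous_cayleyCircle : Continuous cayleyCircle := by
  refine Continuous.subtype_mk (continuous_iff_continuousAt.mpr fun t => ?_) _
  induction t using OnePoint.rec with
  | infty =>
    rw [OnePoint.continuousAt_infty', coclosedCompact_eq_cocompact]
    have h1 : Tendsto (fun s : ℝ => Complex.I * s + 1) (cocompact ℝ) (Bornology.cobounded ℂ) := by
      rw [← tendsto_norm_atTop_iff_cobounded]
      refine tendsto_atTop_mono (fun s => ?_) (tendsto_norm_cocompact_atTop (E := ℝ))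
      simpa using Complex.abs_im_le_norm (Complex.I * s + 1)
    have h2 := (tendsto_inv₀_cobounded.comp h1).const_mul (2 : ℂ) |>.const_sub (1 : ℂ)
    rw [mul_zero, sub_zero] at h2
    exact h2.congr fun s => (cayley_coe s).symm
  | coe s =>
    rw [OnePoint.continuousAt_coe]
    change ContinuousAt (fun s : ℝ => cayley s) s
    simp only [cayley_coe]
    exact continuousAt_const.sub (continuousAt_const.mul (ContinuousAt.inv₀ (by fun_prop)
      (I_mul_add_one_ne_zero s)))

variable {n : ℕ}

theorem smash_eq_coe_iff {t : Fin n → OnePoint ℝ} {s : Fin n → ℝ} :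
    smash t = (s : Sphere n) ↔ ∀ j, t j = s j := by
  unfold smash
  split_ifs with h
  · obtain ⟨j, hj⟩ := h
    refine ⟨fun h' => absurd h'.symm (OnePoint.coe_ne_infty s), fun h' => ?_⟩
    rw [h' j] at hj
    exact absurd hj (OnePoint.coe_ne_infty _)
  · push Not at h
    choose r hr using fun j => OnePoint.ne_infty_iff_exists.mp (h j)
    obtain rfl : (fun j => (r j : OnePoint ℝ)) = t := funext hr
    rw [OnePoint.coe_eq_coe]
    simp only [OnePoint.coe_eq_coe]
    exact funext_iff

theorem smash_coe (s : Fin n → ℝ) : smash (fun j => (s j : OnePoint ℝ)) = (s : Sphere n) :=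
  smash_eq_coe_iff.mpr fun _ => rfl

theorem smash_eq_infty_iff {t : Fin n → OnePoint ℝ} : smash t = ∞ ↔ ∃ j, t j = ∞ := by
  unfold smash
  split_ifs with h
  · simpa using h
  · simpa using h

theorem smash_surjective (hn : n ≠ 0) : Function.Surjective (smash : _ → Sphere n) := by
  intro x
  induction x using OnePoint.rec with
  -- The basepoint needs a coordinate equal to `∞`: for `n = 0` the only tuple is sent to the point
  -- of `ℝ⁰`.
  | infty => exact ⟨fun _ => ∞, smash_eq_infty_iff.mpr ⟨⟨0, Nat.pos_of_ne_zero hn⟩, rfl⟩⟩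
  | coe s => exact ⟨_, smash_coe s⟩

/-- Near a tuple with `t j = ∞`, the `j`-th coordinate alone controls the value: once it leaves the
compact `j`-th projection of `K`, the smash product leaves `K`. Elsewhere the map is the inclusion
of `ℝⁿ` in an open chart. -/
theorem continuous_smash : Continuous (smash : (Fin n → OnePoint ℝ) → Sphere n) := by
  refine continuous_iff_continuousAt.mpr fun t => ?_
  by_cases h : ∃ j, t j = ∞
  · rw [ContinuousAt, smash_eq_infty_iff.mpr h, OnePoint.hasBasis_nhds_infty.tendsto_right_iff]
    rintro K ⟨-, hK⟩
    obtain ⟨j, hj⟩ := h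
    have hKj : IsCompact ((fun s : Fin n → ℝ => s j) '' K) := hK.image (continuous_apply j)
    have h1 : ((↑) '' ((fun s : Fin n → ℝ => s j) '' K) : Set (OnePoint ℝ))ᶜ ∈ 𝓝 (t j) := by
      refine (hKj.image OnePoint.continuous_coe).isClosed.isOpen_compl.mem_nhds ?_
      rw [hj]
      exact OnePoint.infty_notMem_image_coe
    filter_upwards [(continuous_apply j).continuousAt h1] with t' ht'
    by_cases h' : smash t' = ∞
    · exact Or.inr h'
    · obtain ⟨s, hs⟩ := OnePoint.ne_infty_iff_exists.mp h'
      refine Or.inl ⟨s, fun hsK => ht' ?_, hs⟩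
      exact ⟨s j, ⟨s, hsK, rfl⟩, (smash_eq_coe_iff.mp hs.symm j).symm⟩
  · push Not at h
    choose r hr using fun j => OnePoint.ne_infty_iff_exists.mp (h j)
    obtain rfl : (fun j => (r j : OnePoint ℝ)) = t := funext hr
    have hemb : IsOpenEmbedding (Pi.map fun (_ : Fin n) (s : ℝ) => (s : OnePoint ℝ)) :=
      .piMap fun _ => OnePoint.isOpenEmbedding_coe
    refine (hemb.continuousAt_iff (x := r)).mp ?_
    have : smash ∘ (Pi.map fun (_ : Fin n) (s : ℝ) => (s : OnePoint ℝ)) =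
        ((↑) : (Fin n → ℝ) → Sphere n) := funext smash_coe
    rw [this]
    exact OnePoint.continuous_coe.continuousAt

end Cayley

/-! ### Diagonalization of commuting tuples -/

section Diagonalization

variable {U : Type} [NormedAddCommGroup U] [InnerProductSpace ℂ U] {n : ℕ}

/-- An isometric embedding of `ℂ^ι` with prescribed orthonormal values on the standard basis. -/
theorem exists_isometry {ι : Type} [Fintype ι] [DecidableEq ι] {v : ι → U}
    (hv : Orthonormal ℂ v) :
    ∃ f : EuclideanSpace ℂ ι →ₗᵢ[ℂ] U, ∀ a, f (EuclideanSpace.single a 1) = v a := by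
  let b := EuclideanSpace.basisFun ι ℂ
  have hb : ⇑(b.toBasis.constr ℂ v) ∘ b.toBasis = v := funext fun a => b.toBasis.constr_basis ℂ v a
  have h1 : Orthonormal ℂ b.toBasis := by
    rw [b.coe_toBasis]
    exact b.orthonormal
  refine ⟨(b.toBasis.constr ℂ v).isometryOfOrthonormal h1 (hb.symm ▸ hv), fun a => ?_⟩
  rw [LinearMap.coe_isometryOfOrthonormal]
  have := congrFun hb a
  rwa [Function.comp_apply, b.coe_toBasis, EuclideanSpace.basisFun_apply] at this

/-- Orthonormal bases of the entries combine to one orthonormal family since the entries are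
mutually orthogonal. -/
theorem OrthTuple.ofEmb_surjective {k : ℕ} (V : OrthTuple U k) :
    ∃ (d : Fin k → ℕ) (f : EuclideanSpace ℂ (Σ i : Fin k, Fin (d i)) →ₗᵢ[ℂ] U),
      OrthTuple.ofEmb d f = V := by
  obtain ⟨V, hfin, hV⟩ := V
  have hV' : OrthogonalFamily ℂ (fun i => V i) fun i => (V i).subtypeₗᵢ :=
    OrthogonalFamily.of_pairwise hV
  let b := fun i => stdOrthonormalBasis ℂ (V i)
  obtain ⟨f, hf⟩ := exists_isometry
    (hV'.orthonormal_sigma_orthonormal (v_family := fun i => b i) fun i => (b i).orthonormal)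
  refine ⟨fun i => Module.finrank ℂ (V i), f, Subtype.ext (funext fun i => ?_)⟩
  change Submodule.span ℂ (Set.range fun a => f (EuclideanSpace.single ⟨i, a⟩ 1)) = V i
  simp only [hf]
  have h1 : (Set.range fun a => (V i).subtypeₗᵢ (b i a)) = (V i).subtype '' Set.range (b i) := by
    rw [← Set.range_comp]
    rfl
  rw [h1, Submodule.span_image, ← (b i).coe_toBasis, (b i).toBasis.span_eq, Submodule.map_top,
    Submodule.range_subtype]

/-- The unitaries that are the identity on the orthogonal complement of `V`. -/
def unitaryOn (V : Submodule ℂ U) : Set (stableUnitary U) := {A | ∀ x ∈ Vᗮ, A.1 x = x}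

theorem unitaryOn_mono {V W : Submodule ℂ U} (h : V ≤ W) : unitaryOn V ⊆ unitaryOn W :=
  fun _ hA x hx => hA x (Submodule.orthogonal_le h hx)

/-- `A` preserves inner products and fixes `Vᗮ` pointwise, so it preserves `Vᗮᗮ`, which is `V` in
finite dimension. -/
theorem mapsTo_of_mem_unitaryOn {V : Submodule ℂ U} [FiniteDimensional ℂ V] {A : stableUnitary U}
    (hA : A ∈ unitaryOn V) {x : U} (hx : x ∈ V) : A.1 x ∈ V := by
  rw [← Submodule.orthogonal_orthogonal V]
  intro y hy
  rw [← hA y hy, A.1.inner_map_map]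
  exact Submodule.inner_left_of_mem_orthogonal hx hy

theorem inv_mem_unitaryOn {V : Submodule ℂ U} {A : stableUnitary U} (hA : A ∈ unitaryOn V) :
    A⁻¹ ∈ unitaryOn V := fun x hx => by
  conv_lhs => rw [← hA x hx]
  exact A.1.symm_apply_apply x

open Module.End in
/-- Commuting unitaries on a finite dimensional space have an orthonormal basis of joint
eigenvectors. -/
theorem exists_orthonormalBasis_joint_eigenvectors (V : Submodule ℂ U) [FiniteDimensional ℂ V]
    (A : CommTuple U n) (hA : ∀ j, A.1 j ∈ unitaryOn V) :
    ∃ (b : OrthonormalBasis (Fin (Module.finrank ℂ V)) ℂ V)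
      (w : Fin (Module.finrank ℂ V) → Fin n → Circle),
      ∀ i j, (A.1 j).1 (b i) = (w i j : ℂ) • (b i : U) := by
  classical
  let B : Fin n → V →ₗ[ℂ] V := fun j =>
    ((A.1 j).1.toLinearEquiv : U →ₗ[ℂ] U).restrict fun x hx => mapsTo_of_mem_unitaryOn (hA j) hx
  let B' : Fin n → V →ₗ[ℂ] V := fun j =>
    ((A.1 j)⁻¹.1.toLinearEquiv : U →ₗ[ℂ] U).restrict
      fun x hx => mapsTo_of_mem_unitaryOn (inv_mem_unitaryOn (hA j)) hx
  have hB : ∀ j x, (B j x : U) = (A.1 j).1 x := fun _ _ => rfl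
  have hB' : ∀ j x, (B' j x : U) = (A.1 j)⁻¹.1 x := fun _ _ => rfl
  have hadj : ∀ j x y, inner ℂ (B j x) y = inner ℂ x (B' j y) := fun j x y => by
    rw [Submodule.coe_inner, Submodule.coe_inner, hB, hB', ← (A.1 j).1.inner_map_map (x : U)]
    exact congrArg _ ((A.1 j).1.apply_symm_apply y).symm
  have hadj' : ∀ j x y, inner ℂ (B' j x) y = inner ℂ x (B j y) := fun j x y => by
    rw [← inner_conj_symm, ← hadj, inner_conj_symm]
  have hc : ∀ (X Y : stableUnitary U), X * Y = Y * X → ∀ x : U, X.1 (Y.1 x) = Y.1 (X.1 x) :=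
    fun X Y h x => congrArg (fun Z : stableUnitary U => Z.1 x) h
  have hBB : ∀ i j, Commute (B i) (B j) := fun i j => LinearMap.ext fun x =>
    Subtype.ext (hc _ _ (A.2 i j) x)
  have hBB' : ∀ i j, Commute (B i) (B' j) := fun i j => LinearMap.ext fun x =>
    Subtype.ext (hc _ _ (show Commute (A.1 i) (A.1 j) from A.2 i j).inv_right x)
  have hB'B' : ∀ i j, Commute (B' i) (B' j) := fun i j => LinearMap.ext fun x =>
    Subtype.ext (hc _ _ (show Commute (A.1 i) (A.1 j) from A.2 i j).inv_inv x)
  -- `B' j` is both inverse and adjoint of `B j`, so `B + B'` and `i (B - B')` are symmetric. This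
  -- reduces unitaries to the spectral theorem for commuting symmetric operators.
  let T : Fin n × Bool → V →ₗ[ℂ] V := fun p =>
    if p.2 then B p.1 + B' p.1 else Complex.I • (B p.1 - B' p.1)
  have hTs : ∀ p, (T p).IsSymmetric := by
    rintro ⟨j, _ | _⟩ x y
    · change inner ℂ (Complex.I • (B j x - B' j x)) y = inner ℂ x (Complex.I • (B j y - B' j y))
      rw [inner_smul_left, inner_smul_right, inner_sub_left, inner_sub_right, hadj, hadj',
        Complex.conj_I]
      ring
    · change inner ℂ (B j x + B' j x) y = inner ℂ x (B j y + B' j y)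
      rw [inner_add_left, inner_add_right, hadj, hadj', add_comm]
  have hP : ∀ i j, Commute (B i + B' i) (B j + B' j) := fun i j =>
    ((hBB i j).add_right (hBB' i j)).add_left ((hBB' j i).symm.add_right (hB'B' i j))
  have hM : ∀ i j, Commute (B i - B' i) (B j - B' j) := fun i j =>
    ((hBB i j).sub_right (hBB' i j)).sub_left ((hBB' j i).symm.sub_right (hB'B' i j))
  have hPM : ∀ i j, Commute (B i + B' i) (B j - B' j) := fun i j =>
    ((hBB i j).sub_right (hBB' i j)).add_left ((hBB' j i).symm.sub_right (hB'B' i j))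
  have hTc : ∀ p q, Commute (T p) (T q) := by
    rintro ⟨i, _ | _⟩ ⟨j, _ | _⟩
    · exact ((hM i j).smul_left _).smul_right _
    · exact ((hPM j i).symm.smul_left _)
    · exact (hPM i j).smul_right _
    · exact hP i j
  have hint := LinearMap.IsSymmetric.directSum_isInternal_of_pairwise_commute hTs
    fun p q _ => hTc p q
  have horth := LinearMap.IsSymmetric.orthogonalFamily_iInf_eigenspaces hTs
  let E : (Fin n × Bool → ℂ) → Submodule ℂ V := fun α => ⨅ p, eigenspace (T p) (α p)
  -- Only finitely many joint eigenspaces are nonzero; discarding the others gives a finite index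
  -- type, from which an orthonormal basis can be assembled.
  have hint' : DirectSum.IsInternal fun α : {α // E α ≠ ⊥} => E α :=
    DirectSum.isInternal_ne_bot_iff.mpr hint
  have horth' : OrthogonalFamily ℂ (fun α : {α // E α ≠ ⊥} => E α) fun α => (E α).subtypeₗᵢ :=
    horth.comp Subtype.val_injective
  have : Fintype {α // E α ≠ ⊥} :=
    (Submodule.finite_ne_bot_of_iSupIndep hint.submodule_iSupIndep).fintype
  let b := hint'.subordinateOrthonormalBasis rfl horth'
  let α := fun i => (hint'.subordinateOrthonormalBasisIndex rfl i horth').1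
  have hb : ∀ i p, T p (b i) = α i p • b i := fun i p => mem_eigenspace_iff.mp
    ((Submodule.mem_iInf _).mp (hint'.subordinateOrthonormalBasis_subordinate rfl i horth') p)
  have hw : ∀ i j, ∃ w : Circle, (A.1 j).1 (b i) = (w : ℂ) • (b i : U) := by
    intro i j
    -- Recovers `B` from its symmetric parts: `2 B = (B + B') - i (i (B - B'))`.
    let c : ℂ := (α i (j, true) - Complex.I * α i (j, false)) / 2
    have h1 : B j (b i) + B' j (b i) = α i (j, true) • b i := hb i (j, true)
    have h2 : Complex.I • (B j (b i) - B' j (b i)) = α i (j, false) • b i := hb i (j, false)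
    have h3 : B j (b i) = c • b i := by
      have h4 : c • b i = (1 / 2 : ℂ) • (α i (j, true) • b i) -
          (Complex.I / 2) • (α i (j, false) • b i) := by
        simp only [c]
        module
      rw [h4, ← h1, ← h2, smul_smul, show Complex.I / 2 * Complex.I = -(1 / 2) by
        rw [div_mul_eq_mul_div, Complex.I_mul_I, neg_div]]
      module
    have h5 : (A.1 j).1 (b i) = c • (b i : U) := congrArg Subtype.val h3
    have h6 : ‖c‖ = 1 := by
      have := congrArg norm h5
      rw [norm_smul, LinearIsometryEquiv.norm_map, ← Submodule.coe_norm, b.norm_eq_one,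
        mul_one] at this
      exact this.symm
    exact ⟨⟨c, mem_sphere_zero_iff_norm.mpr h6⟩, h5⟩
  choose w hw using hw
  exact ⟨b, w, hw⟩

/-- A commuting tuple of unitaries that are the identity on the complement of `V` is diagonal in an
orthonormal basis of `V`. -/
theorem exists_eq_diagTuple (V : Submodule ℂ U) [FiniteDimensional ℂ V]
    (A : CommTuple U n) (hA : ∀ j, A.1 j ∈ unitaryOn V) :
    ∃ (f : EuclideanSpace ℂ (Σ _ : Fin (Module.finrank ℂ V), Fin 1) →ₗᵢ[ℂ] V)
      (t : Fin (Module.finrank ℂ V) → Fin n → OnePoint ℝ),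
      A = diagTuple (V.subtypeₗᵢ.comp f) fun p j => cayleyCircle (t p.1 j) := by
  obtain ⟨b, w, hw⟩ := exists_orthonormalBasis_joint_eigenvectors V A hA
  choose t ht using fun i j => cayleyCircle_surjective (w i j)
  -- The index type `Σ _, Fin 1` is that of a configuration whose labels are all lines, so that `f`
  -- can also serve as a frame for `OrthTuple.ofEmb`.
  obtain ⟨f, hf⟩ := exists_isometry (ι := Σ _ : Fin (Module.finrank ℂ V), Fin 1)
    (v := fun p => b p.1) (b.orthonormal.comp _ fun p q h =>
      Sigma.ext h (heq_of_eq (Subsingleton.elim _ _)))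
  have hf' : ∀ p, V.subtypeₗᵢ.comp f (EuclideanSpace.single p 1) = b p.1 :=
    fun p => congrArg Subtype.val (hf p)
  refine ⟨f, t, Subtype.ext (funext fun j => Subtype.ext (LinearIsometryEquiv.ext fun x => ?_))⟩
  rw [diagTuple_coe]
  obtain ⟨r, hr, hxr⟩ := exists_eq_sum_add (V.subtypeₗᵢ.comp f) x
  have hrV : r ∈ Vᗮ := by
    intro v hv
    have hv' : (⟨v, hv⟩ : V) = ∑ i, inner ℂ (b i) ⟨v, hv⟩ • b i := (b.sum_repr' ⟨v, hv⟩).symm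
    have hv'' := congrArg V.subtype hv'
    rw [map_sum] at hv''
    change v = _ at hv''
    rw [hv'', sum_inner]
    refine Finset.sum_eq_zero fun i _ => ?_
    rw [map_smul, inner_smul_left]
    have := hr ⟨i, 0⟩
    rw [hf'] at this
    exact mul_eq_zero_of_right _ this
  rw [hxr, map_add, map_add, map_sum, map_sum, hA j r hrV, diagIso_of_inner_eq_zero _ _ hr]
  congr 1
  refine Finset.sum_congr rfl fun p _ => ?_
  rw [map_smul, map_smul, diagIso_basis, hf', hw, ht]

end Diagonalization

attribute [local instance] stiefelTopology unitaryTopology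

open Topology

/-! ### Stiefel manifolds and stable unitary groups -/

section Stable

variable {U : Type} [NormedAddCommGroup U] [InnerProductSpace ℂ U]
variable {W : Type} [NormedAddCommGroup W] [InnerProductSpace ℂ W]

theorem continuous_stiefel_apply (w : W) : Continuous fun f : W →ₗᵢ[ℂ] U => f w :=
  have h : Continuous fun f : W →ₗᵢ[ℂ] U => f.toContinuousLinearMap := continuous_induced_dom
  (ContinuousLinearMap.apply ℂ U w).continuous.comp h

theorem toContinuousLinearMap_injective :
    Function.Injective fun f : W →ₗᵢ[ℂ] U => f.toContinuousLinearMap :=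
  fun _ _ h => LinearIsometry.ext fun w => congrArg (fun T : W →L[ℂ] U => T w) h

instance : T2Space (W →ₗᵢ[ℂ] U) :=
  .of_injective_continuous toContinuousLinearMap_injective continuous_induced_dom

instance [FiniteDimensional ℂ W] [FiniteDimensional ℂ U] : CompactSpace (W →ₗᵢ[ℂ] U) := by
  have hind : IsInducing fun f : W →ₗᵢ[ℂ] U => f.toContinuousLinearMap := ⟨rfl⟩
  rw [← isCompact_univ_iff, hind.isCompact_iff, Set.image_univ]
  have hrange : (Set.range fun f : W →ₗᵢ[ℂ] U => f.toContinuousLinearMap) =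
      ⋂ w : W, {T : W →L[ℂ] U | ‖T w‖ = ‖w‖} := by
    ext T
    simp only [Set.mem_range, Set.mem_iInter, Set.mem_ofPred_eq]
    refine ⟨?_, fun h => ⟨⟨T, h⟩, rfl⟩⟩
    rintro ⟨f, rfl⟩ w
    exact f.norm_map w
  have : ProperSpace (W →L[ℂ] U) := FiniteDimensional.proper ℂ _
  refine Metric.isCompact_of_isClosed_isBounded ?_ ?_
  · rw [hrange]
    exact isClosed_iInter fun w => isClosed_eq
      (ContinuousLinearMap.apply ℂ U w).continuous.norm continuous_const
  · refine (isBounded_iff_forall_norm_le).mpr ⟨1, ?_⟩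
    rintro _ ⟨f, rfl⟩
    exact f.norm_toContinuousLinearMap_le

theorem continuous_of_continuous_apply {V : Type} [NormedAddCommGroup V] [InnerProductSpace ℂ V]
    [FiniteDimensional ℂ V] {Y : Type} [TopologicalSpace Y] {F : Y → V ≃ₗᵢ[ℂ] V}
    (h : ∀ v, Continuous fun y => F y v) : Continuous F :=
  continuous_induced_rng.mpr (continuous_clm_apply.mpr h)

theorem continuous_extendById (V : Submodule ℂ U) [hV : FiniteDimensional ℂ V] :
    Continuous (extendById V) :=
  continuous_iff_coinduced_le.mpr
    (le_iSup₂ (f := fun (V : Submodule ℂ U) (_ : FiniteDimensional ℂ V) =>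
      TopologicalSpace.coinduced (extendById V) (unitaryTopology V)) V hV)

/-- A stable unitary as a continuous linear map. -/
def toCLM (A : stableUnitary U) : U →L[ℂ] U := A.1.toLinearIsometry.toContinuousLinearMap

theorem toCLM_injective : Function.Injective (toCLM : stableUnitary U → U →L[ℂ] U) :=
  fun _ _ h => Subtype.ext (LinearIsometryEquiv.ext fun x =>
    congrArg (fun T : U →L[ℂ] U => T x) h)

theorem toCLM_mul (A B : stableUnitary U) : toCLM (A * B) = toCLM A * toCLM B := rfl

/-- On each `U(V)` this map is affine in the unitary. Comparing with the operator norm gives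
Hausdorffness and closedness of the commutation relations without discussing multiplication in the
colimit topology. -/
theorem continuous_toCLM : Continuous (toCLM : stableUnitary U → U →L[ℂ] U) := by
  refine continuous_iSup_dom.mpr fun V => continuous_iSup_dom.mpr fun hV =>
    continuous_coinduced_dom.mpr ?_
  let P : U →L[ℂ] V := V.orthogonalProjectionOnto
  have h : toCLM ∘ extendById V = fun B : V ≃ₗᵢ[ℂ] V =>
      V.subtypeL.comp (B.toLinearIsometry.toContinuousLinearMap.comp P) +
        (ContinuousLinearMap.id ℂ U - V.subtypeL.comp P) := rfl
  rw [h]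
  have h1 : Continuous fun B : V ≃ₗᵢ[ℂ] V => B.toLinearIsometry.toContinuousLinearMap :=
    continuous_induced_dom
  exact (continuous_const.clm_comp (h1.clm_comp continuous_const)).add continuous_const

instance : T2Space (stableUnitary U) := .of_injective_continuous toCLM_injective continuous_toCLM

theorem isClosed_commTuple (n : ℕ) :
    IsClosed {A : Fin n → stableUnitary U | ∀ i j, A i * A j = A j * A i} := by
  have : {A : Fin n → stableUnitary U | ∀ i j, A i * A j = A j * A i} =
      ⋂ (i) (j), {A | toCLM (A i) * toCLM (A j) = toCLM (A j) * toCLM (A i)} := by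
    ext A
    simp only [Set.mem_ofPred_eq, Set.mem_iInter, ← toCLM_mul, toCLM_injective.eq_iff]
  rw [this]
  have hc : ∀ i, Continuous fun A : Fin n → stableUnitary U => toCLM (A i) :=
    fun i => continuous_toCLM.comp (continuous_apply i)
  exact isClosed_iInter fun i => isClosed_iInter fun j =>
    isClosed_eq ((hc i).mul (hc j)) ((hc j).mul (hc i))

variable {ι : Type} [Fintype ι] [DecidableEq ι]

/-- Continuity into the colimit is available through the maps from `U(V)`, so diagonal unitaries
with eigenvectors in `V` have to be recognized as extensions from `V`. -/
theorem extendById_diagIso (V : Submodule ℂ U) [FiniteDimensional ℂ V]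
    (f : EuclideanSpace ℂ ι →ₗᵢ[ℂ] V) (w : ι → Circle) :
    (extendById V (diagIso f w)).1 = diagIso (V.subtypeₗᵢ.comp f) w := by
  ext x
  change extendLin V (diagIso f w) x = _
  rw [extendLin_apply, diagIso_apply, diagIso_apply, diagLin_apply, diagLin_apply]
  have h : ∀ a, inner ℂ (f (EuclideanSpace.single a 1)) (V.orthogonalProjectionOnto x) =
      inner ℂ (V.subtypeₗᵢ.comp f (EuclideanSpace.single a 1)) x :=
    fun a => V.inner_orthogonalProjectionOnto_eq_of_mem_left _ x
  simp only [h, Submodule.coe_add, Submodule.coe_sum, Submodule.coe_smul]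
  rw [add_right_comm, add_sub_cancel]
  rfl

theorem continuous_diagTuple (V : Submodule ℂ U) [FiniteDimensional ℂ V] (n : ℕ) :
    Continuous fun p : (EuclideanSpace ℂ ι →ₗᵢ[ℂ] V) × (ι → Fin n → Circle) =>
      diagTuple (V.subtypeₗᵢ.comp p.1) p.2 := by
  refine Continuous.subtype_mk (continuous_pi fun j => ?_) _
  have h : (fun p : (EuclideanSpace ℂ ι →ₗᵢ[ℂ] V) × (ι → Fin n → Circle) =>
      (⟨diagIso (V.subtypeₗᵢ.comp p.1) fun a => p.2 a j, diagIso_mem _ _⟩ : stableUnitary U)) =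
      fun p => extendById V (diagIso p.1 fun a => p.2 a j) :=
    funext fun p => Subtype.ext (extendById_diagIso V p.1 _).symm
  rw [h]
  refine (continuous_extendById V).comp (continuous_of_continuous_apply fun v => ?_)
  simp only [diagIso_apply, diagLin_apply]
  have h1 : ∀ a : ι, Continuous fun p : (EuclideanSpace ℂ ι →ₗᵢ[ℂ] V) × (ι → Fin n → Circle) =>
      p.1 (EuclideanSpace.single a 1) := fun a => (continuous_stiefel_apply _).comp continuous_fst
  have h2 : ∀ a : ι, Continuous fun p : (EuclideanSpace ℂ ι →ₗᵢ[ℂ] V) × (ι → Fin n → Circle) =>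
      (p.2 a j : ℂ) := fun a => continuous_subtype_val.comp
        ((continuous_apply j).comp ((continuous_apply a).comp continuous_snd))
  exact continuous_const.add (continuous_finsetSum _ fun a _ =>
    (((h2 a).sub continuous_const).mul ((h1 a).inner continuous_const)).smul (h1 a))

/-- The diagonal tuple with the given eigenvectors and (Cayley transforms of) eigenvalues. -/
def cayleyTuple {n k : ℕ} {d : Fin k → ℕ}
    (f : EuclideanSpace ℂ (Σ i : Fin k, Fin (d i)) →ₗᵢ[ℂ] U) (t : Fin k → Fin n → OnePoint ℝ) :
    CommTuple U n := diagTuple f fun p j => cayleyCircle (t p.1 j)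

theorem continuous_cayleyTuple (V : Submodule ℂ U) [FiniteDimensional ℂ V] (n : ℕ) {k : ℕ}
    (d : Fin k → ℕ) : Continuous fun p : (EuclideanSpace ℂ (Σ i : Fin k, Fin (d i)) →ₗᵢ[ℂ] V) ×
      (Fin k → Fin n → OnePoint ℝ) => cayleyTuple (V.subtypeₗᵢ.comp p.1) p.2 := by
  have h : Continuous fun p : (EuclideanSpace ℂ (Σ i : Fin k, Fin (d i)) →ₗᵢ[ℂ] V) ×
      (Fin k → Fin n → OnePoint ℝ) => fun (q : Σ i : Fin k, Fin (d i)) (j : Fin n) =>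
        cayleyCircle (p.2 q.1 j) := continuous_pi fun q => continuous_pi fun j =>
    continuous_cayleyCircle.comp
      ((continuous_apply j).comp ((continuous_apply q.1).comp continuous_snd))
  have h2 := continuous_fst.prodMk h
  have h3 := (continuous_diagTuple V n).comp h2
  exact h3

theorem cayleyTuple_mem_unitaryOn (V : Submodule ℂ U) {n k : ℕ} {d : Fin k → ℕ}
    (f : EuclideanSpace ℂ (Σ i : Fin k, Fin (d i)) →ₗᵢ[ℂ] V) (t : Fin k → Fin n → OnePoint ℝ)
    (j : Fin n) : (cayleyTuple (V.subtypeₗᵢ.comp f) t).1 j ∈ unitaryOn V := fun _ hx =>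
  diagIso_of_inner_eq_zero _ _ fun a => hx _ (f (EuclideanSpace.single a 1)).2

/-- By diagonalization of a single unitary, this set is a continuous image of the compact space of
frames in `V` and eigenvalue parameters. -/
theorem isCompact_unitaryOn (V : Submodule ℂ U) [FiniteDimensional ℂ V] :
    IsCompact (unitaryOn V) := by
  let R : (EuclideanSpace ℂ (Σ _ : Fin (Module.finrank ℂ V), Fin 1) →ₗᵢ[ℂ] V) ×
      (Fin (Module.finrank ℂ V) → Fin 1 → OnePoint ℝ) → stableUnitary U :=
    fun p => (cayleyTuple (V.subtypeₗᵢ.comp p.1) p.2).1 0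
  have hR : Continuous R :=
    (continuous_apply 0).comp (continuous_subtype_val.comp (continuous_cayleyTuple V 1 _))
  have : unitaryOn V = Set.range R := by
    refine Set.Subset.antisymm (fun A hA => ?_) ?_
    · obtain ⟨f, t, h⟩ := exists_eq_diagTuple (n := 1) V ⟨fun _ => A, fun _ _ => rfl⟩ fun _ => hA
      exact ⟨(f, t), (congrFun (congrArg Subtype.val h) 0).symm⟩
    · rintro _ ⟨p, rfl⟩
      exact cayleyTuple_mem_unitaryOn V p.1 p.2 0
  rw [this]
  exact isCompact_range hR

/-- An increasing sequence of finite dimensional subspaces that is cofinal among all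
finite dimensional subspaces. -/
structure Exhausts (V : ℕ → Submodule ℂ U) : Prop where
  mono : Monotone V
  fin : ∀ m, FiniteDimensional ℂ (V m)
  exists_le : ∀ W : Submodule ℂ U, FiniteDimensional ℂ W → ∃ m, W ≤ V m

theorem extendById_mem_unitaryOn (V : Submodule ℂ U) [FiniteDimensional ℂ V] (B : V ≃ₗᵢ[ℂ] V) :
    extendById V B ∈ unitaryOn V := fun x hx => by
  change extendLin V B x = x
  have h : V.orthogonalProjectionOnto x = 0 := V.orthogonalProjectionOnto_eq_zero_iff.mpr hx
  rw [extendLin_apply, h, map_zero, Submodule.coe_zero, sub_zero, zero_add]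

/-- The colimit runs over all finite dimensional `W`, but each `U(W)` lands in some `unitaryOn (V
m)`, so a cofinal sequence is enough to test closedness. -/
theorem isKOmega_unitaryOn {V : ℕ → Submodule ℂ U} (hV : Exhausts V) :
    IsKOmega fun m => unitaryOn (V m) where
  mono _ _ h := unitaryOn_mono (hV.mono h)
  isCompact m := have := hV.fin m; isCompact_unitaryOn (V m)
  exists_mem A := by
    obtain ⟨W, hW, hA⟩ := A.2
    exact (hV.exists_le W hW).imp fun m hm => unitaryOn_mono hm hA
  isClosed S hS := by
    refine isClosed_iSup_iff.mpr fun W => isClosed_iSup_iff.mpr fun hW => ?_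
    rw [isClosed_coinduced]
    obtain ⟨m, hm⟩ := hV.exists_le W hW
    have : extendById W ⁻¹' S = extendById W ⁻¹' (S ∩ unitaryOn (V m)) :=
      Set.ext fun B => ⟨fun h => ⟨h, unitaryOn_mono hm (extendById_mem_unitaryOn W B)⟩,
        fun h => h.1⟩
    rw [this]
    exact (hS m).preimage (continuous_extendById W)

theorem exhausts_of_basis {κ : Type} [Countable κ] (b : Module.Basis κ ℂ U) :
    ∃ V : ℕ → Submodule ℂ U, Exhausts V := by
  obtain ⟨e, he⟩ := exists_injective_nat κ
  let V : ℕ → Submodule ℂ U := fun m => Submodule.span ℂ (b '' {a | e a < m})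
  have hmono : Monotone V := fun m m' h =>
    Submodule.span_mono (Set.image_mono fun a ha => lt_of_lt_of_le ha h)
  have hmem : ∀ x : U, ∃ m, x ∈ V m := by
    intro x
    induction b.mem_span x using Submodule.span_induction with
    | mem x hx =>
      obtain ⟨a, rfl⟩ := hx
      exact ⟨e a + 1, Submodule.subset_span ⟨a, Nat.lt_succ_self _, rfl⟩⟩
    | zero => exact ⟨0, zero_mem _⟩
    | add x y _ _ hx hy =>
      obtain ⟨m, hm⟩ := hx
      obtain ⟨m', hm'⟩ := hy
      exact ⟨max m m', add_mem (hmono (le_max_left _ _) hm) (hmono (le_max_right _ _) hm')⟩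
    | smul c x _ hx => exact hx.imp fun m hm => Submodule.smul_mem _ c hm
  refine ⟨V, hmono, fun m => FiniteDimensional.span_of_finite ℂ
    (((Set.finite_lt_nat m).preimage he.injOn).image b), fun W hW => ?_⟩
  obtain ⟨S, hS⟩ := (Submodule.fg_iff_finiteDimensional W).mpr hW
  choose m hm using hmem
  refine ⟨S.sup m, hS ▸ Submodule.span_le.mpr fun x hx => ?_⟩
  exact hmono (Finset.le_sup hx) (hm x)

end Stable

/-! ### Continuous maps out of spaces of configurations -/

section Maps

variable {U : Type} [NormedAddCommGroup U] [InnerProductSpace ℂ U] {k : ℕ}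

/-- The tuple of the subspaces of `V` that are spanned by the images of the summands. -/
def tupleIn (d : Fin k → ℕ) (V : Submodule ℂ U)
    (f : EuclideanSpace ℂ (Σ i : Fin k, Fin (d i)) →ₗᵢ[ℂ] V) : OrthTuple U k :=
  OrthTuple.ofEmb d (V.subtypeₗᵢ.comp f)

theorem continuous_tupleIn (d : Fin k → ℕ) (V : Submodule ℂ U) [hV : FiniteDimensional ℂ V] :
    Continuous (tupleIn d V) := by
  let I (V : Submodule ℂ U) (f : EuclideanSpace ℂ (Σ i : Fin k, Fin (d i)) →ₗᵢ[ℂ] V) :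
    Emb (EuclideanSpace ℂ (Σ i : Fin k, Fin (d i))) U := V.subtypeₗᵢ.comp f
  have h1 : Continuous (I V) := continuous_iff_coinduced_le.mpr
    (le_iSup₂ (f := fun (V : Submodule ℂ U) (_ : FiniteDimensional ℂ V) =>
      TopologicalSpace.coinduced (I V) (stiefelTopology _ V)) V hV)
  have h2 : Continuous fun p : Σ d : Fin k → ℕ, Emb (EuclideanSpace ℂ (Σ i, Fin (d i))) U =>
      OrthTuple.ofEmb p.1 p.2 := continuous_coinduced_rng
  have h3 : Continuous fun f : Emb (EuclideanSpace ℂ (Σ i : Fin k, Fin (d i))) U =>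
      (⟨d, f⟩ : Σ d : Fin k → ℕ, Emb (EuclideanSpace ℂ (Σ i, Fin (d i))) U) :=
    continuous_sigmaMk (σ := fun d : Fin k → ℕ => Emb (EuclideanSpace ℂ (Σ i, Fin (d i))) U)
  exact h2.comp (h3.comp h1)

theorem exists_eq_tupleIn (T : OrthTuple U k) : ∃ (d : Fin k → ℕ) (V : Submodule ℂ U)
    (_ : FiniteDimensional ℂ V) (f : EuclideanSpace ℂ (Σ i : Fin k, Fin (d i)) →ₗᵢ[ℂ] V),
    tupleIn d V f = T := by
  obtain ⟨d, f, h⟩ := T.ofEmb_surjective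
  exact ⟨d, LinearMap.range f.toLinearMap, inferInstance, f.equivRange.toLinearIsometry, h⟩

/-- A product with `Y` need not preserve a coinduced topology. Local compactness of `Y` allows
currying: continuity into `C(Y, Z)` can be tested on the Stiefel manifolds, and evaluation brings it
back. -/
theorem continuous_of_continuous_tupleIn {Y Z : Type} [TopologicalSpace Y] [TopologicalSpace Z]
    [LocallyCompactSpace Y] {g : OrthTuple U k × Y → Z}
    (h : ∀ (d : Fin k → ℕ) (V : Submodule ℂ U) [FiniteDimensional ℂ V],
      Continuous fun p : (EuclideanSpace ℂ (Σ i : Fin k, Fin (d i)) →ₗᵢ[ℂ] V) × Y =>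
        g (tupleIn d V p.1, p.2)) : Continuous g := by
  have h1 : ∀ T, Continuous fun y => g (T, y) := by
    intro T
    obtain ⟨d, V, hV, f, rfl⟩ := exists_eq_tupleIn T
    have h1 := (h d V).comp
      ((continuous_const (y := f)).prodMk (continuous_id (X := Y)))
    exact h1
  let G : OrthTuple U k → C(Y, Z) := fun T => ⟨_, h1 T⟩
  have hG : Continuous G := by
    refine continuous_coinduced_dom.mpr (continuous_sigma_iff.mpr fun d =>
      continuous_iSup_dom.mpr fun V => continuous_iSup_dom.mpr fun hV =>
        continuous_coinduced_dom.mpr ?_)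
    exact (ContinuousMap.curry ⟨_, h d V⟩).continuous
  exact ContinuousMap.continuous_uncurry_of_continuous ⟨G, hG⟩

variable {X : Type} [TopologicalSpace X] {pt : X}

theorem KU.continuous_mk : Continuous fun p : OrthTuple U k × (Fin k → X) => KU.mk pt p.1 p.2 :=
  continuous_quot_mk.comp (continuous_sigmaMk (σ := fun k => OrthTuple U k × (Fin k → X)))

theorem KU.continuous_of_comp_mk {Z : Type} [TopologicalSpace Z] {g : KU pt U → Z}
    (h : ∀ k, Continuous fun p : OrthTuple U k × (Fin k → X) => g (KU.mk pt p.1 p.2)) :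
    Continuous g :=
  continuous_coinduced_dom.mpr (continuous_sigma_iff.mpr h)

end Maps

/-! ### The comparison map -/

section Comparison

variable {U : Type} [NormedAddCommGroup U] [InnerProductSpace ℂ U] {n : ℕ}

/-- The configuration of the subspaces spanned by the images of the summands, at the points
`smash (t i)`. -/
def config {k : ℕ} {d : Fin k → ℕ} (f : EuclideanSpace ℂ (Σ i : Fin k, Fin (d i)) →ₗᵢ[ℂ] U)
    (t : Fin k → Fin n → OnePoint ℝ) : KU (∞ : Sphere n) U :=
  KU.mk ∞ (OrthTuple.ofEmb d f) fun i => smash (t i)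

/-- Both sides are spanned by the frame vectors whose point `smash (t i)` is `s`, as the Cayley
transform is injective. This is the dictionary between tuples and configurations. -/
theorem eigen_cayleyTuple (hn : n ≠ 0) {k : ℕ} {d : Fin k → ℕ}
    (f : EuclideanSpace ℂ (Σ i : Fin k, Fin (d i)) →ₗᵢ[ℂ] U) (t : Fin k → Fin n → OnePoint ℝ)
    (s : Fin n → ℝ) : (cayleyTuple f t).eigen (fun j => cayleyCircle (s j)) =
      (config f t).label ⟨s, OnePoint.coe_ne_infty s⟩ := by
  have hz : ∀ j, cayleyCircle (s j) ≠ 1 := fun j => cayleyCircle_coe_ne_one (s j)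
  have hs : ∀ i : Fin k, (fun j => cayleyCircle (t i j)) = (fun j => cayleyCircle (s j)) ↔
      smash (t i) = (s : Sphere n) := fun i => by
    rw [smash_eq_coe_iff, funext_iff]
    exact forall_congr' fun j => cayleyCircle_injective.eq_iff
  rw [cayleyTuple, eigen_diagTuple f _ hn hz, config, KU.label_mk]
  refine le_antisymm (Submodule.span_le.mpr ?_) (labelSum_le fun i hi => Submodule.span_le.mpr ?_)
  · rintro _ ⟨p, hp, rfl⟩
    exact le_labelSum (OrthTuple.ofEmb d f).1 ((hs p.1).mp hp) (Submodule.subset_span ⟨p.2, rfl⟩)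
  · rintro _ ⟨a, rfl⟩
    exact Submodule.subset_span ⟨⟨i, a⟩, (hs i).mpr hi, rfl⟩

theorem exists_eq_config (hn : n ≠ 0) (c : KU (∞ : Sphere n) U) :
    ∃ (k : ℕ) (d : Fin k → ℕ) (f : EuclideanSpace ℂ (Σ i : Fin k, Fin (d i)) →ₗᵢ[ℂ] U)
      (t : Fin k → Fin n → OnePoint ℝ), c = config f t := by
  obtain ⟨k, V, x⟩ := c
  obtain ⟨d, f, rfl⟩ := V.ofEmb_surjective
  choose t ht using fun i => smash_surjective hn (x i)
  obtain rfl : (fun i => smash (t i)) = x := funext ht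
  exact ⟨k, d, f, t, rfl⟩

theorem exists_eq_cayleyTuple (A : CommTuple U n) (V : Submodule ℂ U) [FiniteDimensional ℂ V]
    (hA : ∀ j, A.1 j ∈ unitaryOn V) :
    ∃ (f : EuclideanSpace ℂ (Σ _ : Fin (Module.finrank ℂ V), Fin 1) →ₗᵢ[ℂ] V)
      (t : Fin (Module.finrank ℂ V) → Fin n → OnePoint ℝ),
      A = cayleyTuple (V.subtypeₗᵢ.comp f) t := exists_eq_diagTuple V A hA

theorem exists_eq_coe_of_ne_one {z : Fin n → Circle} (hz : ∀ j, z j ≠ 1) :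
    ∃ s : Fin n → ℝ, z = fun j => cayleyCircle (s j) := by
  choose t ht using fun j => cayleyCircle_surjective (z j)
  have h : ∀ j, t j ≠ ∞ := fun j h => hz j (by rw [← ht, h, cayleyCircle_infty])
  choose s hs using fun j => OnePoint.ne_infty_iff_exists.mp (h j)
  exact ⟨s, funext fun j => by rw [hs, ht]⟩

/-- Each side says that the labels, equivalently the eigenspaces without eigenvalue `1`, agree. One
direction makes the comparison map well defined, the other makes it injective. -/
theorem config_eq_iff (hn : n ≠ 0) {k k' : ℕ} {d : Fin k → ℕ} {d' : Fin k' → ℕ}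
    (f : EuclideanSpace ℂ (Σ i : Fin k, Fin (d i)) →ₗᵢ[ℂ] U) (t : Fin k → Fin n → OnePoint ℝ)
    (f' : EuclideanSpace ℂ (Σ i : Fin k', Fin (d' i)) →ₗᵢ[ℂ] U)
    (t' : Fin k' → Fin n → OnePoint ℝ) :
    config f t = config f' t' ↔ CommQuot.mk (cayleyTuple f t) = CommQuot.mk (cayleyTuple f' t') := by
  constructor
  · intro h
    refine Quotient.sound (rel_of_eigen_eq f _ f' _ hn fun z hz => ?_)
    obtain ⟨s, rfl⟩ := exists_eq_coe_of_ne_one hz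
    exact (eigen_cayleyTuple hn f t s).trans ((h ▸ rfl : _ = _).trans
      (eigen_cayleyTuple hn f' t' s).symm)
  · intro h
    refine KU.label_injective (funext fun ⟨x, hx⟩ => ?_)
    obtain ⟨s, rfl⟩ := OnePoint.ne_infty_iff_exists.mp hx
    rw [← eigen_cayleyTuple hn f t s, ← eigen_cayleyTuple hn f' t' s]
    exact CommTuple.eigen_eq_of_rel (Quotient.exact h) fun j => cayleyCircle_coe_ne_one (s j)

/-- The map that sends a configuration to the class of the commuting tuple with the labels as
joint eigenspaces, and with the Cayley transforms of the points as eigenvalues. -/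
def comparison (hn : n ≠ 0) (c : KU (∞ : Sphere n) U) : CommQuot U n :=
  CommQuot.mk (cayleyTuple (exists_eq_config hn c).choose_spec.choose_spec.choose
    (exists_eq_config hn c).choose_spec.choose_spec.choose_spec.choose)

theorem comparison_config (hn : n ≠ 0) {k : ℕ} {d : Fin k → ℕ}
    (f : EuclideanSpace ℂ (Σ i : Fin k, Fin (d i)) →ₗᵢ[ℂ] U) (t : Fin k → Fin n → OnePoint ℝ) :
    comparison hn (config f t) = CommQuot.mk (cayleyTuple f t) :=
  ((config_eq_iff hn _ _ _ _).mp
    (exists_eq_config hn (config f t)).choose_spec.choose_spec.choose_spec.choose_spec).symm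

theorem comparison_injective (hn : n ≠ 0) :
    Function.Injective (comparison hn : KU (∞ : Sphere n) U → CommQuot U n) := by
  intro c c' h
  obtain ⟨k, d, f, t, rfl⟩ := exists_eq_config hn c
  obtain ⟨k', d', f', t', rfl⟩ := exists_eq_config hn c'
  rw [comparison_config, comparison_config] at h
  exact (config_eq_iff hn _ _ _ _).mpr h

theorem comparison_surjective (hn : n ≠ 0) :
    Function.Surjective (comparison hn : KU (∞ : Sphere n) U → CommQuot U n) := by
  rintro ⟨A⟩
  choose V hV hA using fun j => (A.1 j).2
  have : ∀ j, FiniteDimensional ℂ (V j) := hV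
  obtain ⟨f, t, h⟩ := exists_eq_cayleyTuple A (⨆ j, V j)
    fun j => unitaryOn_mono (le_iSup V j) (hA j)
  refine ⟨config ((⨆ j, V j).subtypeₗᵢ.comp f) t, ?_⟩
  rw [comparison_config, ← h]
  rfl

theorem continuous_config (V : Submodule ℂ U) [FiniteDimensional ℂ V] {k : ℕ} (d : Fin k → ℕ) :
    Continuous fun p : (EuclideanSpace ℂ (Σ i : Fin k, Fin (d i)) →ₗᵢ[ℂ] V) ×
      (Fin k → Fin n → OnePoint ℝ) => config (V.subtypeₗᵢ.comp p.1) p.2 := by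
  have h : Continuous fun p : (EuclideanSpace ℂ (Σ i : Fin k, Fin (d i)) →ₗᵢ[ℂ] V) ×
      (Fin k → Fin n → OnePoint ℝ) => fun i => smash (p.2 i) :=
    continuous_pi fun i => continuous_smash.comp ((continuous_apply i).comp continuous_snd)
  have h' := ((continuous_tupleIn d V).comp (continuous_fst
    (Y := Fin k → Fin n → OnePoint ℝ))).prodMk h
  have h'' := (KU.continuous_mk (U := U) (pt := (∞ : Sphere n))).comp h'
  exact h''

/-- A continuous surjection from a compact to a Hausdorff space is closed, hence a quotient map. It
lets points of `Sⁿ` be replaced by coordinates in `S¹`. -/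
theorem isQuotientMap_smash (hn : n ≠ 0) (k : ℕ) :
    IsQuotientMap fun (t : Fin k → Fin n → OnePoint ℝ) (i : Fin k) => smash (t i) := by
  have hc : Continuous fun (t : Fin k → Fin n → OnePoint ℝ) (i : Fin k) => smash (t i) :=
    continuous_pi fun i => continuous_smash.comp (continuous_apply i)
  refine hc.isClosedMap.isQuotientMap hc fun x => ?_
  choose t ht using fun i => smash_surjective hn (x i)
  exact ⟨t, funext ht⟩

theorem continuous_comparison (hn : n ≠ 0) :
    Continuous (comparison hn : KU (∞ : Sphere n) U → CommQuot U n) := by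
  refine KU.continuous_of_comp_mk fun k => continuous_of_continuous_tupleIn fun d V hV => ?_
  -- The quotient map stays one after multiplying with the Stiefel manifold because the latter is
  -- compact Hausdorff.
  refine (isQuotientMap_smash hn k).continuous_lift_prod_right (g := fun p :
    (EuclideanSpace ℂ (Σ i : Fin k, Fin (d i)) →ₗᵢ[ℂ] V) × (Fin k → Sphere n) =>
      comparison hn (KU.mk ∞ (tupleIn d V p.1) p.2)) ?_
  have h : (fun p : (EuclideanSpace ℂ (Σ i : Fin k, Fin (d i)) →ₗᵢ[ℂ] V) ×
      (Fin k → Fin n → OnePoint ℝ) =>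
        comparison hn (KU.mk ∞ (tupleIn d V p.1) fun i => smash (p.2 i))) =
      fun p => CommQuot.mk (cayleyTuple (V.subtypeₗᵢ.comp p.1) p.2) :=
    funext fun p => comparison_config hn _ _
  have hmk : Continuous (CommQuot.mk : CommTuple U n → CommQuot U n) := continuous_quotient_mk'
  have h' := hmk.comp (continuous_cayleyTuple V n d)
  rw [h]
  exact h'

/-- Commuting tuples form a closed subset of the `k_ω`-space of all tuples, so closedness is tested
at each stage `V m`. There the tuples coming from `F` are the image under `R` of the compact set `q
⁻¹' F`. -/
theorem isClosedMap_comparison (hn : n ≠ 0) {V : ℕ → Submodule ℂ U} (hV : Exhausts V) :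
    IsClosedMap (comparison hn : KU (∞ : Sphere n) U → CommQuot U n) := by
  intro F hF
  have hq : IsQuotientMap (CommQuot.mk : CommTuple U n → CommQuot U n) :=
    isQuotientMap_quotient_mk'
  rw [← hq.isClosed_preimage,
    (isClosed_commTuple n).isClosedEmbedding_subtypeVal.isClosed_iff_image_isClosed]
  refine ((isKOmega_unitaryOn hV).pi (Fin n)).isClosed _ fun m => ?_
  have := hV.fin m
  let d : Fin (Module.finrank ℂ (V m)) → ℕ := fun _ => 1
  let R : (EuclideanSpace ℂ (Σ i, Fin (d i)) →ₗᵢ[ℂ] V m) ×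
      (Fin (Module.finrank ℂ (V m)) → Fin n → OnePoint ℝ) → CommTuple U n :=
    fun p => cayleyTuple ((V m).subtypeₗᵢ.comp p.1) p.2
  let q : (EuclideanSpace ℂ (Σ i, Fin (d i)) →ₗᵢ[ℂ] V m) ×
      (Fin (Module.finrank ℂ (V m)) → Fin n → OnePoint ℝ) → KU (∞ : Sphere n) U :=
    fun p => config ((V m).subtypeₗᵢ.comp p.1) p.2
  have hR : Continuous R := continuous_cayleyTuple (V m) n d
  have hqc : Continuous q := continuous_config (V m) d
  have hqR : ∀ p, comparison hn (q p) = CommQuot.mk (R p) := fun p => comparison_config hn _ _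
  have himage : Subtype.val '' ((CommQuot.mk : CommTuple U n → CommQuot U n) ⁻¹'
      (comparison hn '' F)) ∩ Set.univ.pi (fun _ => unitaryOn (V m)) =
      (fun p => (R p).1) '' (q ⁻¹' F) := by
    refine Set.Subset.antisymm ?_ ?_
    · rintro _ ⟨⟨A, ⟨c, hc, hcA⟩, rfl⟩, hA⟩
      obtain ⟨f, t, h⟩ := exists_eq_cayleyTuple A (V m) fun j => hA j (Set.mem_univ j)
      refine ⟨(f, t), ?_, congrArg Subtype.val h.symm⟩
      -- Injectivity shows that every diagonalization of a tuple coming from `F`, not just some, has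
      -- its configuration in `F`.
      have : q (f, t) = c := comparison_injective hn ((hqR (f, t)).trans (hcA ▸ h ▸ rfl))
      exact Set.mem_preimage.mpr (this ▸ hc)
    · rintro _ ⟨p, hp, rfl⟩
      exact ⟨⟨R p, ⟨q p, hp, hqR p⟩, rfl⟩, fun j _ => cayleyTuple_mem_unitaryOn _ p.1 p.2 j⟩
  exact (congrArg IsClosed himage).mpr
    ((hF.preimage hqc).isCompact.image (continuous_subtype_val.comp hR)).isClosed

/-- The comparison map is a homeomorphism. -/
def comparisonHomeomorph (hn : n ≠ 0) {V : ℕ → Submodule ℂ U} (hV : Exhausts V) :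
    KU (∞ : Sphere n) U ≃ₜ CommQuot U n :=
  Equiv.toHomeomorphOfContinuousClosed
    (Equiv.ofBijective _ ⟨comparison_injective hn, comparison_surjective hn⟩)
    (continuous_comparison hn) (isClosedMap_comparison hn hV)

theorem comparison_base (hn : n ≠ 0) :
    comparison hn (KU.base (∞ : Sphere n) U) = CommQuot.mk ⟨fun _ => 1, fun _ _ => rfl⟩ := by
  -- The basepoint is also the empty configuration, whose diagonal tuple has no eigenvectors and is
  -- therefore the identity.
  let f : EuclideanSpace ℂ (Σ i : Fin 0, Fin (0 : ℕ)) →ₗᵢ[ℂ] U :=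
    ⟨0, fun x => by rw [Subsingleton.elim x 0]; simp⟩
  have h1 : KU.base (∞ : Sphere n) U = config (d := fun _ => 0) f Fin.elim0 := by
    refine KU.label_injective (funext fun s => ?_)
    rw [KU.label_base, config, KU.label_mk]
    exact (le_bot_iff.mp (labelSum_le fun i => i.elim0)).symm
  rw [h1, comparison_config]
  congr 1
  refine Subtype.ext (funext fun j => Subtype.ext (LinearIsometryEquiv.ext fun x => ?_))
  exact diagIso_of_inner_eq_zero _ _ fun a => a.1.elim0

theorem sphereAct_smash (σ : Equiv.Perm (Fin n)) (t : Fin n → OnePoint ℝ) :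
    sphereAct σ (smash t) = smash fun j => t (σ⁻¹ j) := by
  by_cases h : smash t = ∞
  · rw [h]
    obtain ⟨j, hj⟩ := smash_eq_infty_iff.mp h
    exact (smash_eq_infty_iff.mpr ⟨σ j, (congrArg t (σ.symm_apply_apply j)).trans hj⟩).symm
  · obtain ⟨s, hs⟩ := OnePoint.ne_infty_iff_exists.mp h
    rw [← hs]
    exact (smash_eq_coe_iff.mpr fun j => smash_eq_coe_iff.mp hs.symm (σ⁻¹ j)).symm

theorem map_config (g : U ≃ₗᵢ[ℂ] U) (σ : Equiv.Perm (Fin n)) {k : ℕ} {d : Fin k → ℕ}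
    (f : EuclideanSpace ℂ (Σ i : Fin k, Fin (d i)) →ₗᵢ[ℂ] U) (t : Fin k → Fin n → OnePoint ℝ) :
    KU.map ∞ g (sphereAct σ) rfl (config f t) =
      config (g.toLinearIsometry.comp f) fun i j => t i (σ⁻¹ j) := by
  have h1 : (OrthTuple.ofEmb d f).map g = OrthTuple.ofEmb d (g.toLinearIsometry.comp f) := by
    refine Subtype.ext (funext fun i => ?_)
    refine (Submodule.map_span _ _).trans (congrArg (Submodule.span ℂ) ?_)
    exact (Set.range_comp _ _).symm
  change KU.mk ∞ ((OrthTuple.ofEmb d f).map g) (fun i => sphereAct σ (smash (t i))) = _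
  rw [h1]
  simp only [sphereAct_smash]
  rfl

/-- Conjugation by `g` moves eigenvectors by `g` and keeps eigenvalues, as `g` does with labels and
points; `σ` permutes coordinates of points and members of the tuple in the same way. -/
theorem comparison_equivariant (hn : n ≠ 0) (g : U ≃ₗᵢ[ℂ] U) (σ : Equiv.Perm (Fin n))
    (c : KU (∞ : Sphere n) U) :
    comparison hn (KU.map ∞ g (sphereAct σ) rfl c) = CommQuot.act g σ (comparison hn c) := by
  obtain ⟨k, d, f, t, rfl⟩ := exists_eq_config hn c
  rw [map_config, comparison_config, comparison_config]
  change _ = CommQuot.mk ((cayleyTuple f t).act g σ)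
  congr 1
  refine Subtype.ext (funext fun j => Subtype.ext (LinearIsometryEquiv.ext fun x => ?_))
  change diagLin _ _ x = g (diagLin f _ (g.symm x))
  rw [diagLin_apply, diagLin_apply, map_add, g.apply_symm_apply, map_sum]
  congr 1
  refine Finset.sum_congr rfl fun a _ => ?_
  have h2 : inner ℂ (f (EuclideanSpace.single a 1)) (g.symm x) =
      inner ℂ (g.toLinearIsometry.comp f (EuclideanSpace.single a 1)) x := by
    rw [← g.inner_map_map _ (g.symm x), g.apply_symm_apply]
    rfl
  rw [map_smul, h2]
  rfl

end Comparison

/-! ### The symmetric algebra and the case `n = 0` -/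

theorem SymC.exhausts (n : ℕ) : ∃ V : ℕ → Submodule ℂ (SymC n), Exhausts V :=
  exhausts_of_basis (SymC.monomials n)

instance : DiscreteTopology (Sphere 0) :=
  have : Finite (Sphere 0) := inferInstanceAs (Finite (Option (Fin 0 → ℝ)))
  inferInstance

theorem SymC.submodule_eq_bot_or_top (S : Submodule ℂ (SymC 0)) : S = ⊥ ∨ S = ⊤ := by
  have h : Module.finrank ℂ (SymC 0) = 1 := by
    rw [Module.finrank_eq_card_basis (SymC.monomials 0), Fintype.card_unique]
  have : IsSimpleOrder (Submodule ℂ (SymC 0)) := is_simple_module_of_finrank_eq_one (A := ℂ) h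
  exact eq_bot_or_eq_top S

/-- The point of `S⁰` different from the basepoint. -/
def Sphere.zero : {s : Sphere 0 // s ≠ ∞} :=
  ⟨((0 : Fin 0 → ℝ) : OnePoint (Fin 0 → ℝ)), OnePoint.coe_ne_infty _⟩

theorem Sphere.eq_zero (s : {s : Sphere 0 // s ≠ ∞}) : s = Sphere.zero := by
  obtain ⟨x, hx⟩ := OnePoint.ne_infty_iff_exists.mp s.2
  refine Subtype.ext (hx.symm.trans ?_)
  rw [Subsingleton.elim x 0]
  rfl

open scoped Classical in
/-- The map `ku_0 → S⁰` that detects the label of the point different from the basepoint. -/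
def comparisonZero (c : ku 0) : Sphere 0 := if c.label Sphere.zero = ⊥ then ∞ else Sphere.zero.1

/-- `S⁰` has one point besides the basepoint, and its label is a subspace of the line `Sym(ℂ⁰)`, so
it is zero or everything. -/
theorem comparisonZero_bijective : Function.Bijective comparisonZero := by
  constructor
  · intro c c' h
    refine KU.label_injective (funext fun s => ?_)
    rw [Sphere.eq_zero s]
    unfold comparisonZero at h
    split_ifs at h with h1 h2 h2
    · rw [h1, h2]
    · exact absurd h.symm Sphere.zero.2
    · exact absurd h Sphere.zero.2
    · rw [(SymC.submodule_eq_bot_or_top _).resolve_left h1,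
        (SymC.submodule_eq_bot_or_top _).resolve_left h2]
  · intro s
    by_cases hs : s = ∞
    · exact ⟨KU.base ∞ _, by rw [comparisonZero, if_pos (KU.label_base _), hs]⟩
    · have : FiniteDimensional ℂ (SymC 0) := (SymC.monomials 0).finiteDimensional_of_finite
      let V : OrthTuple (SymC 0) 1 := ⟨fun _ => ⊤, fun _ => inferInstance,
        fun i j hij => absurd (Subsingleton.elim i j) hij⟩
      refine ⟨KU.mk ∞ V fun _ => Sphere.zero.1, ?_⟩
      have hV : (KU.mk ∞ V fun _ => Sphere.zero.1).label Sphere.zero = ⊤ :=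
        top_le_iff.mp (le_labelSum V.1 (i := 0) rfl)
      have : Nontrivial (SymC 0) := (SymC.monomials 0).repr.toEquiv.nontrivial
      rw [comparisonZero, hV, if_neg top_ne_bot]
      exact (congrArg Subtype.val (Sphere.eq_zero ⟨s, hs⟩)).symm

/-- Whether the label vanishes depends only on the dimensions `d` and on the points, not on the
frame, and the points vary in a discrete space. -/
theorem continuous_comparisonZero : Continuous comparisonZero := by
  refine KU.continuous_of_comp_mk fun k => continuous_of_continuous_tupleIn fun d V hV => ?_
  have h : ∀ (f : EuclideanSpace ℂ (Σ i : Fin k, Fin (d i)) →ₗᵢ[ℂ] V) (x : Fin k → Sphere 0),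
      (KU.mk ∞ (tupleIn d V f) x).label Sphere.zero = ⊥ ↔ ∀ i, x i = Sphere.zero.1 → d i = 0 := by
    intro f x
    constructor
    · intro h i hi
      by_contra hd
      have h1 : (tupleIn d V f).1 i ≤ ⊥ := h ▸ le_labelSum (tupleIn d V f).1 hi
      let p : Σ i : Fin k, Fin (d i) := ⟨i, ⟨0, Nat.pos_of_ne_zero hd⟩⟩
      have h2 : V.subtypeₗᵢ.comp f (EuclideanSpace.single p 1) = 0 :=
        (Submodule.mem_bot ℂ).mp (h1 (Submodule.subset_span ⟨p.2, rfl⟩))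
      have h3 := inner_basis (V.subtypeₗᵢ.comp f) p p
      rw [h2, inner_zero_left, if_pos rfl] at h3
      exact zero_ne_one h3
    · intro h
      refine le_bot_iff.mp (labelSum_le fun i hi => Submodule.span_le.mpr ?_)
      rintro _ ⟨a, rfl⟩
      exact (Fin.cast (h i hi) a).elim0
  classical
  have h' : (fun p : (EuclideanSpace ℂ (Σ i : Fin k, Fin (d i)) →ₗᵢ[ℂ] V) × (Fin k → Sphere 0) =>
      comparisonZero (KU.mk ∞ (tupleIn d V p.1) p.2)) =
      (fun x => if ∀ i, x i = Sphere.zero.1 → d i = 0 then ∞ else Sphere.zero.1) ∘ Prod.snd :=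
    funext fun p => if_congr (h p.1 p.2) rfl rfl
  rw [h']
  exact continuous_of_discreteTopology.comp continuous_snd

/-- The homeomorphism `ku_0 ≃ S⁰`. -/
def comparisonZeroHomeomorph : ku 0 ≃ₜ Sphere 0 :=
  Equiv.toHomeomorphOfContinuousClosed (Equiv.ofBijective _ comparisonZero_bijective)
    continuous_comparisonZero fun _ _ => isClosed_discrete _

/-! ### The explicit formula for the comparison map, and the theorem -/

theorem cayleyTuple_of_mem {n k : ℕ} {d : Fin k → ℕ} {U : Type} [NormedAddCommGroup U]
    [InnerProductSpace ℂ U] (f : EuclideanSpace ℂ (Σ i : Fin k, Fin (d i)) →ₗᵢ[ℂ] U)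
    (t : Fin k → Fin n → OnePoint ℝ) (i : Fin k) (j : Fin n) {v : U}
    (hv : v ∈ (OrthTuple.ofEmb d f).1 i) :
    ((cayleyTuple f t).1 j).1 v = cayley (t i j) • v := by
  induction hv using Submodule.span_induction with
  | mem v hv =>
    obtain ⟨a, rfl⟩ := hv
    exact diagIso_basis f _ ⟨i, a⟩
  | zero => rw [map_zero, smul_zero]
  | add v w _ _ hv hw => rw [map_add, hv, hw, smul_add]
  | smul c v _ hv => rw [map_smul, hv, smul_comm]

theorem cayleyTuple_of_mem_orthogonal {n k : ℕ} {d : Fin k → ℕ} {U : Type} [NormedAddCommGroup U]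
    [InnerProductSpace ℂ U] (f : EuclideanSpace ℂ (Σ i : Fin k, Fin (d i)) →ₗᵢ[ℂ] U)
    (t : Fin k → Fin n → OnePoint ℝ) (j : Fin n) {v : U}
    (hv : v ∈ (⨆ i, (OrthTuple.ofEmb d f).1 i)ᗮ) : ((cayleyTuple f t).1 j).1 v = v :=
  diagIso_of_inner_eq_zero f _ fun a => hv _
    (Submodule.mem_iSup_of_mem a.1 (Submodule.subset_span ⟨a.2, rfl⟩))

end KuModel

end

open KuModel in
theorem lemma2p2 (n : ℕ) :
    ∃ Φ : ku n ≃ₜ CBar n,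
      Φ (KU.base ∞ (SymC n)) = CBar.base n ∧
      (∀ (σ : Equiv.Perm (Fin n)) (c : ku n), Φ (σ • c) = σ • Φ c) ∧
      ∀ (hn : n ≠ 0) (k : ℕ) (V : OrthTuple (SymC n) k) (x : Fin k → Fin n → OnePoint ℝ),
        ∃ A : CommTuple (SymC n) n,
          (∀ i j, ∀ v ∈ V.1 i, (A.1 j).1 v = cayley (x i j) • v) ∧
          (∀ j, ∀ v ∈ (⨆ i, V.1 i)ᗮ, (A.1 j).1 v = v) ∧
          Φ (KU.mk ∞ V fun i => smash (x i)) = CBar.mk hn A := by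
  obtain _ | m := n
  · refine ⟨comparisonZeroHomeomorph, ?_, fun σ c => ?_, fun hn => absurd rfl hn⟩
    · exact if_pos (KU.label_base _)
    · rw [Subsingleton.elim σ 1, one_smul, one_smul]
  · obtain ⟨V, hV⟩ := SymC.exhausts (m + 1)
    refine ⟨comparisonHomeomorph m.succ_ne_zero hV, comparison_base m.succ_ne_zero,
      fun σ c => comparison_equivariant m.succ_ne_zero (SymC.perm σ) σ c, fun hn k T x => ?_⟩
    -- Any frame adapted to the tuple of subspaces supplies the required representative `cayleyTuple
    -- f x`.
    obtain ⟨d, f, rfl⟩ := T.ofEmb_surjective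
    exact ⟨cayleyTuple f x, fun i j v hv => cayleyTuple_of_mem f x i j hv,
      fun j v hv => cayleyTuple_of_mem_orthogonal f x j hv, comparison_config m.succ_ne_zero f x⟩
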